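/- **Setting.** A network is a finite simple graph whose nodes carry pairwise distinct identifiers (natural numbers). Computation takes place in the LOCAL model: initially each node knows the number $n$ of nodes, the maximum degree of the graph, its own identifier, its own degree, and its own advice string; in each synchronous round it exchanges messages of unbounded size with its neighbours and performs an arbitrary local computation. Solving an orientation problem means that each node outputs which of its incident edges it orients outwards, consistently with the other endpoints. For a family $\mathcal G$ of networks and a problem $\Pi$, a $(\mathcal G,\Pi,\beta,T)$-advice schema is a function $f$ assigning to every $G\in\mathcal G$ (the identifiers included) a bit-string $\ell_G(v)$ of length at most $\beta$ for each node $v$, such that some LOCAL algorithm, given these strings, solves $\Pi$ on every $G\in\mathcal G$ in at most $T$ rounds. Nodes with a non-empty string are called bit-holding. A $(\mathcal G,\Pi,\gamma_0,A,T)$-composable advice schema exists if for every $c>0$, every integer $\gamma\ge\gamma_0$ and every integer $\alpha\ge A(c,\gamma)$ there are $\beta\le c\alpha/\gamma^3$ and a $(\mathcal G,\Pi,\beta,T(\alpha))$-advice schema such that for every $G\in\mathcal G$ each ball of radius $\alpha$ in $G$ contains at most $\gamma_0$ bit-holding nodes. A uniform fixed-length sparse $(\mathcal G,\Pi,1,T)$-advice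 schema exists if for every $\varepsilon>0$ there is a $(\mathcal G,\Pi,1,T(\varepsilon))$-advice schema that gives every node exactly one bit and in which, for every $G\in\mathcal G$, the fraction of nodes that receive the bit $1$ is at most $\varepsilon$. **Theorem.** Let $\mathcal G_\Delta$ be the family of all networks of maximum degree at most $\Delta$, and let $\Pi$ be the problem of orienting all edges so that $|\deg_{\rm in}(v)-\deg_{\rm out}(v)|\le 1$ at every node $v$. 1. There are a constant $\gamma_0$, a function $A$ with $A(c,\gamma)=\Theta(\gamma^3)$ for each fixed $c>0$, both independent of $\Delta$, and a function $T(\alpha,\Delta)=\Delta^{O(\alpha)}$ such that for every $\Delta$ there is a $(\mathcal G_\Delta,\Pi,\gamma_0,A,T(\cdot,\Delta))$-composable advice schema. The constant in $O(\alpha)$ is absolute. 2. There is a function $T(\varepsilon,\Delta)$ that is $\Delta^{O(1)}$ for each fixed $\varepsilon>0$ (the exponent may depend on $\varepsilon$ but not on $\Delta$), such that for every $\Delta$ there is a uniform fixed-length sparse $(\mathcal G_\Delta,\Pi,1,T(\cdot,\Delta))$-advice schema. In particular $\Pi$ can be solved in $\Delta^{O(1)}$ rounds with one bit of advice per node. 3.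 Both statements also hold when $\mathcal G_\Delta$ is replaced by the family of all networks of maximum degree at most $\Delta$ in which every node has even degree, and $\Pi$ by the problem of orienting all edges so that $\deg_{\rm in}(v)=\deg_{\rm out}(v)$ at every node $v$. -/

import Mathlib

open Asymptotics Filter

/-- A finite simple graph whose nodes carry pairwise distinct identifiers. -/
structure Network where
  V : Type
  [fintypeV : Fintype V]
  graph : SimpleGraph V
  ident : V → ℕ
  ident_injective : Function.Injective ident

attribute [instance] Network.fintypeV

namespace Network

/-- The number of nodes. -/
def size (N : Network) : ℕ := Fintype.card N.V

open scoped Classical in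
/-- The degree of a node. -/
noncomputable def degree (N : Network) (v : N.V) : ℕ := N.graph.degree v

open scoped Classical in
/-- The maximum degree of the graph. -/
noncomputable def maxDegree (N : Network) : ℕ := N.graph.maxDegree

open scoped Classical in
/-- The (finite) set of neighbours of a node. -/
noncomputable def neighbors (N : Network) (v : N.V) : Finset N.V := N.graph.neighborFinset v

/-- The nodes at distance at most `r` from `v`.  The extended distance is used, so that nodes of
other connected components are at infinite distance. -/
def ball (N : Network) (v : N.V) (r : ℕ) : Set N.V := {u | N.graph.edist v u ≤ (r : ℕ∞)}

end Network

/-! ### The LOCAL model -/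

/-- What a node knows before the first round: the number of nodes, the maximum degree of the graph,
its own identifier, its own degree, and its advice string. -/
structure LocalInput where
  size : ℕ
  maxDegree : ℕ
  ident : ℕ
  degree : ℕ
  advice : List Bool

/-- A deterministic synchronous message-passing algorithm.  In every round each node sends a message
of unbounded size to its neighbours, receives the messages of its neighbours, and updates its state
by an arbitrary computation.  Since messages are unbounded and may contain the identifiers of the
sender and of the intended recipients, sending one common message to all neighbours and receiving
an unordered collection of messages is no restriction.  After `rounds` rounds every node stops
and produces its output from its state. -/
structure LocalAlgorithm (Out : Type) where
  State : Type
  Msg : Type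
  rounds : ℕ
  init : LocalInput → State
  send : State → Msg
  receive : State → Multiset Msg → State
  output : State → Out

namespace LocalAlgorithm

variable {Out : Type}

/-- The initial knowledge of node `v` of `N` under the advice `l`. -/
noncomputable def localInput (N : Network) (l : N.V → List Bool) (v : N.V) : LocalInput where
  size := N.size
  maxDegree := N.maxDegree
  ident := N.ident v
  degree := N.degree v
  advice := l v

/-- The state of every node after a given number of rounds. -/
noncomputable def state (𝒜 : LocalAlgorithm Out) (N : Network) (l : N.V → List Bool) :
    ℕ → N.V → 𝒜.State
  | 0, v => 𝒜.init (localInput N l v)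
  | t + 1, v => 𝒜.receive (state 𝒜 N l t v)
      ((N.neighbors v).val.map fun u => 𝒜.send (state 𝒜 N l t u))

/-- The output of every node. -/
noncomputable def run (𝒜 : LocalAlgorithm Out) (N : Network) (l : N.V → List Bool) (v : N.V) :
    Out :=
  𝒜.output (𝒜.state N l 𝒜.rounds v)

end LocalAlgorithm

/-! ### Advice schemas -/

/-- A graph problem: which assignments of outputs to the nodes are valid solutions. -/
abbrev GraphProblem (Out : Type) : Type 1 := (N : Network) → (N.V → Out) → Prop

/-- A rule assigning a bit-string to every node of every network.  It may depend on the whole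
network, including the identifiers. -/
abbrev AdviceAssignment : Type 1 := (N : Network) → N.V → List Bool

/-- `f` is a `(𝒢, P, β, T)`-advice schema (without further conditions, a variable-length one). -/
def IsAdviceSchema {Out : Type} (𝒢 : Set Network) (P : GraphProblem Out) (β T : ℕ)
    (f : AdviceAssignment) : Prop :=
  (∀ N ∈ 𝒢, ∀ v, (f N v).length ≤ β) ∧
  ∃ 𝒜 : LocalAlgorithm Out, 𝒜.rounds ≤ T ∧ ∀ N ∈ 𝒢, P N (𝒜.run N (f N))

/-- In every graph of the family, all nodes receive strings of the same length. -/
def IsUniformFixedLength (𝒢 : Set Network) (f : AdviceAssignment) : Prop :=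
  ∀ N ∈ 𝒢, ∀ u v, (f N u).length = (f N v).length

/-- The number of nodes of `N` that receive exactly the one-bit string `b`. -/
noncomputable def bitCount (f : AdviceAssignment) (N : Network) (b : Bool) : ℕ :=
  {v : N.V | f N v = [b]}.ncard

/-- `f` is a uniform fixed-length `ε`-sparse `(𝒢, P, 1, T)`-advice schema: every node receives
exactly one bit, and the fraction of nodes that receive the bit 1 is at most `ε`. -/
def IsEpsSparseSchema {Out : Type} (𝒢 : Set Network) (P : GraphProblem Out) (T : ℕ) (ε : ℝ)
    (f : AdviceAssignment) : Prop :=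
  IsAdviceSchema 𝒢 P 1 T f ∧
  IsUniformFixedLength 𝒢 f ∧
  (∀ N ∈ 𝒢, ∀ v, (f N v).length = 1) ∧
  ∀ N ∈ 𝒢, (bitCount f N true : ℝ) / ((bitCount f N false : ℝ) + (bitCount f N true : ℝ)) ≤ ε

/-- There is a uniform fixed-length sparse `(𝒢, P, 1, T)`-advice schema; the number of rounds
may depend on the sparsity `ε`. -/
def HasSparseSchema {Out : Type} (𝒢 : Set Network) (P : GraphProblem Out) (T : ℝ → ℕ) : Prop :=
  ∀ ε : ℝ, 0 < ε → ∃ f : AdviceAssignment, IsEpsSparseSchema 𝒢 P (T ε) ε f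

/-- The bit-holding nodes: those that receive a non-empty string. -/
def bitHolding (f : AdviceAssignment) (N : Network) : Set N.V := {v | f N v ≠ []}

/-- There is a `(𝒢, P, γ₀, A, T)`-composable advice schema, that is, a collection of
variable-length advice schemas, one for all admissible parameters `c`, `γ`, `α`. -/
def HasComposableSchema {Out : Type} (𝒢 : Set Network) (P : GraphProblem Out) (γ₀ : ℕ)
    (A : ℝ → ℕ → ℝ) (T : ℕ → ℕ) : Prop :=
  ∀ c : ℝ, 0 < c → ∀ γ : ℕ, γ₀ ≤ γ → ∀ α : ℕ, A c γ ≤ α →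
    ∃ β : ℕ, (β : ℝ) ≤ c * α / (γ : ℝ) ^ 3 ∧
      ∃ f : AdviceAssignment, IsAdviceSchema 𝒢 P β (T α) f ∧
        ∀ N ∈ 𝒢, ∀ v : N.V, (N.ball v α ∩ bitHolding f N).ncard ≤ γ₀

/-! ### Balanced orientations -/

/-- An orientation of the edges of a simple graph: `dir u v` says that `{u, v}` is an edge that is
oriented from `u` to `v`. -/
structure EdgeOrientation {V : Type} (G : SimpleGraph V) where
  dir : V → V → Prop
  adj_of_dir : ∀ {u v}, dir u v → G.Adj u v
  dir_iff : ∀ {u v}, G.Adj u v → (dir u v ↔ ¬ dir v u)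

namespace EdgeOrientation

variable {V : Type} {G : SimpleGraph V}

/-- The number of incoming edges. -/
noncomputable def indeg (o : EdgeOrientation G) (v : V) : ℕ := {u | o.dir u v}.ncard

/-- The number of outgoing edges. -/
noncomputable def outdeg (o : EdgeOrientation G) (v : V) : ℕ := {u | o.dir v u}.ncard

end EdgeOrientation

/-- The outputs encode the orientation `o`: every node outputs the identifiers of the neighbours
to which its outgoing edges lead. -/
def EncodesOrientation (N : Network) (out : N.V → Finset ℕ) (o : EdgeOrientation N.graph) : Prop :=
  ∀ v, (out v : Set ℕ) = N.ident '' {u | o.dir v u}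

/-- Orient the edges so that indegree and outdegree are equal at every node. -/
def balancedOrientation : GraphProblem (Finset ℕ) := fun N out =>
  ∃ o : EdgeOrientation N.graph, EncodesOrientation N out o ∧ ∀ v, o.indeg v = o.outdeg v

/-- Orient the edges so that indegree and outdegree differ by at most one at every node. -/
def almostBalancedOrientation : GraphProblem (Finset ℕ) := fun N out =>
  ∃ o : EdgeOrientation N.graph, EncodesOrientation N out o ∧
    ∀ v, |(o.indeg v : ℤ) - (o.outdeg v : ℤ)| ≤ 1

/-- Graphs of maximum degree at most `Δ`. -/
def boundedDegree (Δ : ℕ) : Set Network := {N | ∀ v, N.degree v ≤ Δ}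

/-- Graphs of maximum degree at most `Δ` in which all degrees are even. -/
def boundedEvenDegree (Δ : ℕ) : Set Network := {N | ∀ v, N.degree v ≤ Δ ∧ Even (N.degree v)}

/-- The problem `P` has, for every `Δ`, a composable schema on the family `𝒢 Δ`, where
`γ₀ = O(1)`, `A(c, γ) = Θ(γ³)` for every constant `c > 0`, and `T(α, Δ) = Δ ^ O(α)`.
The number `γ₀` and the function `A` do not depend on `Δ`, and the constant hidden in the exponent
depends neither on `Δ` nor on `α`, `c`, `γ`. -/
def HasComposableSchemas (𝒢 : ℕ → Set Network) (P : GraphProblem (Finset ℕ)) : Prop :=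
  ∃ (γ₀ : ℕ) (A : ℝ → ℕ → ℝ) (T : ℕ → ℕ → ℕ),
    (∀ c : ℝ, 0 < c → (fun γ : ℕ => A c γ) =Θ[atTop] fun γ : ℕ => (γ : ℝ) ^ 3) ∧
    (∃ K : ℕ, ∀ α Δ : ℕ, T α Δ ≤ Δ ^ (K * α)) ∧
    ∀ Δ : ℕ, HasComposableSchema (𝒢 Δ) P γ₀ A fun α => T α Δ

/-- The problem `P` has, for every `Δ`, a uniform fixed-length sparse schema with one bit per node
on the family `𝒢 Δ`, with `Δ ^ O(1)` rounds for every fixed sparsity `ε > 0`. -/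
def HasSparseSchemas (𝒢 : ℕ → Set Network) (P : GraphProblem (Finset ℕ)) : Prop :=
  ∃ T : ℝ → ℕ → ℕ,
    (∀ ε : ℝ, 0 < ε → ∃ K : ℕ, ∀ Δ : ℕ, T ε Δ ≤ Δ ^ K) ∧
    ∀ Δ : ℕ, HasSparseSchema (𝒢 Δ) P fun ε => T ε Δ

/-! At each node, pair up the incident edges, leaving at most one over. Following partners
decomposes the edge set into open and closed trails. If every trail is traversed consistently,
paired edges cancel at each node, so the imbalance is at most one, and zero when the degree is even.
The pairing depends only on the set of neighbouring identifiers, so trails can be followed locally.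

Each trail gets a canonical direction, the one containing the directed edge with the least code. If
`l` steps exhaust the trail, a node finds this direction by inspection. Otherwise the advice has to
reveal it, through a correctly directed edge marked within `3 * l` steps.

Marks must be sparse. Take a maximal family of disjoint trail segments of radius `l` around directed
edges whose trail is not exhausted by `l` steps. Each segment has more than `l` directed edges,
while only `(Δ + 1) ^ (R + 1)` directed edges start within distance `R` of a node. With `l` four
times this number, a counting argument (`exists_independent_transversal`) picks one edge from every
segment so that the picks are pairwise more than `R` apart. This is `exists_marks`.

A mark is written with at most three 1s: both endpoints, and a node at distance 3 exactly when the
edge points to the smaller identifier. Separation makes this uniquely readable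
(`markedEdges_markedNodes`), and `decodedDir_iff` recovers the orientation. With `R = 2 * α + 8`,
every ball of radius `α` meets at most one gadget, and the density of 1s is at most `3 / (α + 1)`.
Both schemas follow from this one set of nodes. -/

/-! ### Balls in graphs -/

namespace SimpleGraph

variable {V W : Type*} {G G' : SimpleGraph V} {c x y : V} {k n : ℕ}

/-- The closed ball of radius `k` around `c`. -/
def cball (G : SimpleGraph V) (c : V) (k : ℕ) : Set V := {x | G.edist c x ≤ k}

theorem mem_cball : x ∈ G.cball c k ↔ G.edist c x ≤ k := Iff.rfl

theorem mem_cball_comm : x ∈ G.cball c k ↔ c ∈ G.cball x k := by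
  rw [mem_cball, mem_cball, edist_comm]

theorem mem_cball_self : c ∈ G.cball c k := by simp [mem_cball]

theorem cball_zero : G.cball c 0 = {c} := by
  ext x
  rw [mem_cball, Nat.cast_zero, nonpos_iff_eq_zero, edist_eq_zero_iff, Set.mem_singleton_iff,
    eq_comm]

theorem cball_mono {m : ℕ} (h : k ≤ m) : G.cball c k ⊆ G.cball c m := fun x hx =>
  (mem_cball.1 hx).trans (by exact_mod_cast h)

theorem mem_cball_add {m : ℕ} (hx : x ∈ G.cball c k) (hy : y ∈ G.cball x m) :
    y ∈ G.cball c (k + m) := by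
  rw [mem_cball] at *
  push_cast
  exact G.edist_triangle.trans (add_le_add hx hy)

theorem Adj.mem_cball_one (h : G.Adj x y) : y ∈ G.cball x 1 := by
  rw [mem_cball, Nat.cast_one, edist_le_one_iff_adj_or_eq]
  exact .inl h

theorem exists_mem_cball_of_reachable (h : G.Reachable c x) : ∃ k, x ∈ G.cball c k := by
  obtain ⟨p⟩ := h
  exact ⟨p.length, G.edist_le p⟩

theorem reachable_of_mem_cball (h : x ∈ G.cball c k) : G.Reachable c x :=
  reachable_of_edist_ne_top (ne_top_of_le_ne_top (ENat.natCast_ne_top k) h)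

theorem mem_cball_succ :
    x ∈ G.cball c (k + 1) ↔ x ∈ G.cball c k ∨ ∃ y ∈ G.cball c k, G.Adj y x := by
  constructor
  · intro h
    rw [mem_cball, edist_comm] at h
    obtain ⟨p, hp⟩ := exists_walk_of_edist_ne_top
      (ne_top_of_le_ne_top (ENat.natCast_ne_top (k + 1)) h)
    rw [← hp, Nat.cast_le] at h
    cases p with
    | nil => exact .inl mem_cball_self
    | cons hadj q =>
      refine .inr ⟨_, ?_, hadj.symm⟩
      rw [mem_cball, edist_comm]
      rw [Walk.length_cons] at h
      exact (G.edist_le q).trans (by exact_mod_cast (by omega : q.length ≤ k))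
  · rintro (h | ⟨y, hy, h⟩)
    · exact cball_mono k.le_succ h
    · exact mem_cball_add hy h.mem_cball_one

theorem mem_cball_succ' :
    x ∈ G.cball c (k + 1) ↔ x ∈ G.cball c k ∨ ∃ y, G.Adj c y ∧ x ∈ G.cball y k := by
  rw [mem_cball_comm, mem_cball_succ, mem_cball_comm]
  refine or_congr_right (exists_congr fun y => ?_)
  rw [mem_cball_comm, and_comm, adj_comm]

theorem cball_congr {r : ℕ}
    (h : ∀ k < r, ∀ x ∈ G.cball c k, ∀ y, G.Adj x y ↔ G'.Adj x y) :
    ∀ k ≤ r, G.cball c k = G'.cball c k := by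
  intro k
  induction k with
  | zero => intro _; rw [cball_zero, cball_zero]
  | succ k ih =>
    intro hk
    have ih := ih (by omega)
    ext x
    rw [mem_cball_succ, mem_cball_succ, ← ih]
    refine or_congr_right (exists_congr fun y => and_congr_right fun hy => ?_)
    exact h k (by omega) y hy x

/-- Discrete intermediate values: along an edge the distance from `c` grows by at most one, so no
value is skipped. -/
theorem exists_edist_eq : ∀ {k : ℕ} {x : V}, x ∈ G.cball c k → (n : ℕ∞) ≤ G.edist c x →
    ∃ w, G.edist c w = n := by
  intro k
  induction k with
  | zero =>
    intro x hx hn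
    rw [cball_zero, Set.mem_singleton_iff] at hx
    subst hx
    rw [edist_self] at hn
    exact ⟨x, by rw [edist_self]; exact (le_antisymm hn (zero_le)).symm⟩
  | succ k ih =>
    intro x hx hn
    rw [mem_cball_succ] at hx
    obtain hx | ⟨y, hy, hadj⟩ := hx
    · exact ih hx hn
    · by_cases hle : (n : ℕ∞) ≤ G.edist c y
      · exact ih hy hle
      · refine ⟨x, le_antisymm ?_ hn⟩
        have h1 : G.edist c x ≤ G.edist c y + 1 :=
          G.edist_triangle.trans (add_le_add le_rfl hadj.mem_cball_one)
        exact h1.trans (Order.add_one_le_of_lt (not_le.1 hle))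

/-- Each of the distances `0, ..., n` is attained, and nodes at different distances are different.
-/
theorem lt_ncard_cball (hfin : (G.cball c n).Finite) (hx : G.Reachable c x)
    (hn : (n : ℕ∞) ≤ G.edist c x) : n < (G.cball c n).ncard := by
  obtain ⟨k, hk⟩ := exists_mem_cball_of_reachable hx
  have : ∀ i : ℕ, ∃ w, i ≤ n → G.edist c w = i := fun i => by
    by_cases hi : i ≤ n
    · obtain ⟨w, hw⟩ := exists_edist_eq (n := i) hk (le_trans (by exact_mod_cast hi) hn)
      exact ⟨w, fun _ => hw⟩
    · exact ⟨c, fun h => absurd h hi⟩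
  choose f hf using this
  have hinj : Set.InjOn f (Finset.range (n + 1)) := by
    intro i hi j hj hij
    simp only [Finset.coe_range, Set.mem_Iio] at hi hj
    have h1 := hf i (by omega)
    rw [hij, hf j (by omega)] at h1
    exact_mod_cast h1.symm
  have h2 : f '' (Finset.range (n + 1)) ⊆ G.cball c n := by
    rintro _ ⟨i, hi, rfl⟩
    simp only [Finset.coe_range, Set.mem_Iio] at hi
    rw [mem_cball, hf i (by omega)]
    exact_mod_cast (by omega : i ≤ n)
  have h3 := Set.ncard_le_ncard h2 hfin
  rw [hinj.ncard_image, Set.ncard_coe_finset, Finset.card_range] at h3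
  exact h3

theorem finite_cball_and_ncard_le {D : ℕ}
    (h : ∀ x, (G.neighborSet x).Finite ∧ (G.neighborSet x).ncard ≤ D) (c : V) (k : ℕ) :
    (G.cball c k).Finite ∧ (G.cball c k).ncard ≤ (D + 1) ^ k := by
  classical
  induction k with
  | zero => rw [cball_zero]; simp
  | succ k ih =>
    obtain ⟨hf, hc⟩ := ih
    have hsub : G.cball c (k + 1) =
        ↑(hf.toFinset.biUnion fun x => insert x (h x).1.toFinset) := by
      ext x
      simp only [mem_cball_succ, Finset.coe_biUnion, Set.mem_iUnion, Finset.coe_insert,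
        Set.Finite.coe_toFinset, Set.mem_insert_iff, mem_neighborSet, exists_prop]
      constructor
      · rintro (h | ⟨y, hy, h⟩)
        · exact ⟨x, h, .inl rfl⟩
        · exact ⟨y, hy, .inr h⟩
      · rintro ⟨y, hy, rfl | h⟩
        · exact .inl hy
        · exact .inr ⟨y, hy, h⟩
    rw [hsub, Set.ncard_coe_finset]
    refine ⟨Finset.finite_toSet _, ?_⟩
    have h1 := Finset.card_biUnion_le_card_mul hf.toFinset
      (fun x => insert x (h x).1.toFinset) (D + 1) (fun x _ => by
        refine (Finset.card_insert_le _ _).trans ?_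
        rw [← Set.ncard_eq_toFinset_card _ (h x).1]
        exact Nat.add_le_add_right (h x).2 1)
    rw [← Set.ncard_eq_toFinset_card _ hf] at h1
    rw [pow_succ]
    exact h1.trans (Nat.mul_le_mul_right _ hc)

theorem map_mem_cball {G' : SimpleGraph W} {f : V → W}
    (hf : ∀ x y, G.Adj x y → G'.Adj (f x) (f y)) :
    ∀ {k : ℕ} {x : V}, x ∈ G.cball c k → f x ∈ G'.cball (f c) k := by
  intro k
  induction k with
  | zero => intro x hx; rw [cball_zero] at *; rw [Set.mem_singleton_iff.1 hx]; rfl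
  | succ k ih =>
    intro x hx
    rw [mem_cball_succ] at *
    obtain hx | ⟨y, hy, h⟩ := hx
    · exact .inl (ih hx)
    · exact .inr ⟨_, ih hy, hf _ _ h⟩

theorem cball_map (e : V ↪ W) (c : V) (k : ℕ) :
    (G.map e).cball (e c) k = e '' G.cball c k := by
  induction k with
  | zero => simp [cball_zero]
  | succ k ih =>
    ext x
    rw [mem_cball_succ, ih]
    simp only [Set.mem_image, mem_cball_succ, map_adj]
    constructor
    · rintro (⟨y, hy, rfl⟩ | ⟨_, ⟨y, hy, rfl⟩, u, v, huv, h1, rfl⟩)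
      · exact ⟨y, .inl hy, rfl⟩
      · rw [e.injective h1] at huv
        exact ⟨v, .inr ⟨y, hy, huv⟩, rfl⟩
    · rintro ⟨v, hv | ⟨y, hy, h⟩, rfl⟩
      · exact .inl ⟨v, hv, rfl⟩
      · exact .inr ⟨_, ⟨y, hy, rfl⟩, y, v, h, rfl, rfl⟩

end SimpleGraph

/-! ### Independent transversals by counting -/

section Transversal

variable {ι α : Type*} [Fintype ι] [DecidableEq ι]

open scoped Classical in
/-- The independent transversals of the classes with index in `s`, extended by `a₀`. -/
noncomputable def partialTransversals (C : ι → Finset α) (conf : α → α → Prop) (a₀ : α)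
    (s : Finset ι) : Finset (ι → α) :=
  (Fintype.piFinset fun i => if i ∈ s then C i else {a₀}).filter
    fun f => ∀ i ∈ s, ∀ j ∈ s, i ≠ j → ¬ conf (f i) (f j)

theorem mem_partialTransversals {C : ι → Finset α} {conf : α → α → Prop} {a₀ : α}
    {s : Finset ι} {f : ι → α} : f ∈ partialTransversals C conf a₀ s ↔
      (∀ i ∈ s, f i ∈ C i) ∧ (∀ i ∉ s, f i = a₀) ∧
      ∀ i ∈ s, ∀ j ∈ s, i ≠ j → ¬ conf (f i) (f j) := by
  classical
  rw [partialTransversals, Finset.mem_filter, Fintype.mem_piFinset, ← and_assoc]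
  refine and_congr_left fun _ => ⟨fun h => ⟨fun i hi => ?_, fun i hi => ?_⟩, fun h i => ?_⟩
  · simpa [hi] using h i
  · simpa [hi] using h i
  · by_cases hi : i ∈ s
    · simpa [hi] using h.1 i hi
    · simpa [hi] using h.2 i hi

/-- Once the value at `j` is prescribed, resetting it to `a₀` loses no information. -/
theorem card_partialTransversals_filter_le [DecidableEq α] {C : ι → Finset α}
    {conf : α → α → Prop} {a₀ : α} {s : Finset ι} {j : ι} (hj : j ∈ s) (y : α) :
    ((partialTransversals C conf a₀ s).filter fun f => f j = y).card ≤
      (partialTransversals C conf a₀ (s.erase j)).card := by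
  refine Finset.card_le_card_of_injOn (fun f => Function.update f j a₀) ?_ ?_
  · intro f hf
    rw [Finset.mem_coe, Finset.mem_filter, mem_partialTransversals] at hf
    obtain ⟨⟨h1, h2, h3⟩, -⟩ := hf
    rw [Finset.mem_coe, mem_partialTransversals]
    refine ⟨fun i hi => ?_, fun i hi => ?_, fun i hi k hk hik => ?_⟩
    · rw [Finset.mem_erase] at hi
      simpa [hi.1] using h1 i hi.2
    · by_cases hij : i = j
      · subst hij; simp
      · simp only [Function.update_of_ne hij]
        exact h2 i fun h => hi (Finset.mem_erase.2 ⟨hij, h⟩)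
    · rw [Finset.mem_erase] at hi hk
      simpa [hi.1, hk.1] using h3 i hi.2 k hk.2 hik
  · intro f hf g hg hfg
    simp only [Finset.coe_filter, Set.mem_ofPred_eq] at hf hg
    funext i
    by_cases hij : i = j
    · rw [hij, hf.2, hg.2]
    · have := congrFun hfg i
      simpa [hij] using this

/-- Each new class multiplies the number of transversals by at least half its size. By induction,
prescribing the value at one index `j` leaves at most a fraction `2 / |C j| ≤ 1 / (2 * D)` of the
transversals. A candidate `x` conflicts with at most `D` such values, so by the union bound it
extends at least half of the transversals. -/
theorem card_partialTransversals_insert {C : ι → Finset α} {conf : α → α → Prop}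
    (hsymm : ∀ x y, conf x y → conf y x) {a₀ : α} {D : ℕ} (hD : 0 < D)
    (hcard : ∀ i, 4 * D ≤ (C i).card)
    (hconf : ∀ x, {p : ι × α | p.2 ∈ C p.1 ∧ conf x p.2}.ncard ≤ D) (s : Finset ι) :
    ∀ i ∉ s, (C i).card * (partialTransversals C conf a₀ s).card ≤
      2 * (partialTransversals C conf a₀ (insert i s)).card := by
  classical
  induction s using Finset.strongInduction with
  | H s ih =>
  intro i hi
  set P := partialTransversals C conf a₀ s with hP
  have hbad : ∀ x, 2 * (P.filter fun f => ∃ j ∈ s, conf x (f j)).card ≤ P.card := by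
    intro x
    have hfinp : {p : ι × α | p.2 ∈ C p.1 ∧ conf x p.2}.Finite :=
      (Finset.finite_toSet (Finset.univ ×ˢ Finset.univ.biUnion C)).subset fun p hp => by
        simp only [Finset.coe_product, Set.mem_prod, Finset.mem_coe, Finset.mem_univ,
          Finset.mem_biUnion, true_and]
        exact ⟨_, hp.1⟩
    set Q := hfinp.toFinset.filter fun p => p.1 ∈ s with hQ
    have hQcard : Q.card ≤ D := by
      refine (Finset.card_filter_le _ _).trans ?_
      rw [← Set.ncard_eq_toFinset_card _ hfinp]
      exact hconf x
    have hsub : (P.filter fun f => ∃ j ∈ s, conf x (f j)) ⊆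
        Q.biUnion fun p => P.filter fun f => f p.1 = p.2 := by
      intro f hf
      rw [Finset.mem_filter] at hf
      obtain ⟨hfP, j, hj, hc⟩ := hf
      rw [Finset.mem_biUnion]
      refine ⟨(j, f j), ?_, Finset.mem_filter.2 ⟨hfP, rfl⟩⟩
      rw [hQ, Finset.mem_filter, Set.Finite.mem_toFinset]
      exact ⟨⟨(mem_partialTransversals.1 hfP).1 j hj, hc⟩, hj⟩
    have hone : ∀ p ∈ Q, 2 * D * (P.filter fun f => f p.1 = p.2).card ≤ P.card := by
      intro p hp
      have hps : p.1 ∈ s := (Finset.mem_filter.1 hp).2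
      have h1 := card_partialTransversals_filter_le (C := C) (conf := conf) (a₀ := a₀) hps p.2
      have h2 := ih (s.erase p.1) (Finset.erase_ssubset hps) p.1 (Finset.notMem_erase _ _)
      rw [Finset.insert_erase hps] at h2
      have h3 := Nat.mul_le_mul_right
        (partialTransversals C conf a₀ (s.erase p.1)).card (hcard p.1)
      have h4 := Nat.mul_le_mul_left (2 * D) h1
      rw [← hP] at h4 h2
      nlinarith
    have h5 : D * (2 * (P.filter fun f => ∃ j ∈ s, conf x (f j)).card) ≤ D * P.card := by
      calc D * (2 * (P.filter fun f => ∃ j ∈ s, conf x (f j)).card)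
          ≤ 2 * D * ∑ p ∈ Q, (P.filter fun f => f p.1 = p.2).card := by
            have := (Finset.card_le_card hsub).trans Finset.card_biUnion_le
            calc _ = 2 * D * (P.filter fun f => ∃ j ∈ s, conf x (f j)).card := by ring
              _ ≤ _ := Nat.mul_le_mul_left _ this
        _ = ∑ p ∈ Q, 2 * D * (P.filter fun f => f p.1 = p.2).card := Finset.mul_sum ..
        _ ≤ ∑ _p ∈ Q, P.card := Finset.sum_le_sum hone
        _ = Q.card * P.card := by rw [Finset.sum_const, smul_eq_mul]
        _ ≤ D * P.card := Nat.mul_le_mul_right _ hQcard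
    exact Nat.le_of_mul_le_mul_left h5 hD
  have hgood : ∀ x, P.card ≤ 2 * (P.filter fun f => ¬ ∃ j ∈ s, conf x (f j)).card := by
    intro x
    have h1 := hbad x
    have h2 := Finset.card_filter_add_card_filter_not (s := P)
      (fun f => ∃ j ∈ s, conf x (f j))
    omega
  have hmap : ((C i).sigma fun x => P.filter fun f => ¬ ∃ j ∈ s, conf x (f j)).card ≤
      (partialTransversals C conf a₀ (insert i s)).card := by
    refine Finset.card_le_card_of_injOn (fun q => Function.update q.2 i q.1) ?_ ?_
    · rintro ⟨x, f⟩ hq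
      simp only [Finset.coe_sigma, Set.mem_sigma_iff, Finset.mem_coe, Finset.mem_filter,
        not_exists, not_and] at hq
      obtain ⟨hx, hf, hxf⟩ := hq
      obtain ⟨h1, h2, h3⟩ := mem_partialTransversals.1 hf
      have hne : ∀ j ∈ s, j ≠ i := fun j hj h => hi (h ▸ hj)
      rw [Finset.mem_coe, mem_partialTransversals]
      refine ⟨fun j hj => ?_, fun j hj => ?_, fun j hj k hk hjk => ?_⟩
      · rcases Finset.mem_insert.1 hj with rfl | hj
        · simpa using hx
        · simpa [hne j hj] using h1 j hj
      · rw [Finset.mem_insert, not_or] at hj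
        simpa [hj.1] using h2 j hj.2
      · rcases Finset.mem_insert.1 hj with hji | hj <;>
          rcases Finset.mem_insert.1 hk with hki | hk
        · exact absurd (hji.trans hki.symm) hjk
        · simpa [hji, hne k hk] using hxf k hk
        · simpa [hki, hne j hj] using fun h => hxf j hj (hsymm _ _ h)
        · simpa [hne j hj, hne k hk] using h3 j hj k hk hjk
    · rintro ⟨x, f⟩ hq ⟨y, g⟩ hr hqr
      simp only [Finset.coe_sigma, Set.mem_sigma_iff, Finset.mem_coe, Finset.mem_filter] at hq hr
      have hxy : x = y := by simpa using congrFun hqr i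
      have hfg : f = g := by
        funext j
        by_cases hj : j = i
        · rw [hj, (mem_partialTransversals.1 hq.2.1).2.1 i hi,
            (mem_partialTransversals.1 hr.2.1).2.1 i hi]
        · simpa [hj] using congrFun hqr j
      rw [hxy, hfg]
  rw [Finset.card_sigma] at hmap
  calc (C i).card * P.card = ∑ _x ∈ C i, P.card := by rw [Finset.sum_const, smul_eq_mul]
    _ ≤ ∑ x ∈ C i, 2 * (P.filter fun f => ¬ ∃ j ∈ s, conf x (f j)).card :=
        Finset.sum_le_sum fun x _ => hgood x
    _ = 2 * ∑ x ∈ C i, (P.filter fun f => ¬ ∃ j ∈ s, conf x (f j)).card :=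
        (Finset.mul_sum ..).symm
    _ ≤ _ := Nat.mul_le_mul_left _ hmap

/-- Classes of size at least `4 * D` have an independent transversal if every element conflicts
with at most `D` elements of the classes. -/
theorem exists_independent_transversal [Nonempty α] {C : ι → Finset α} {conf : α → α → Prop}
    (hsymm : ∀ x y, conf x y → conf y x) {D : ℕ} (hD : 0 < D)
    (hcard : ∀ i, 4 * D ≤ (C i).card)
    (hconf : ∀ x, {p : ι × α | p.2 ∈ C p.1 ∧ conf x p.2}.ncard ≤ D) :
    ∃ f : ι → α, (∀ i, f i ∈ C i) ∧ ∀ i j, i ≠ j → ¬ conf (f i) (f j) := by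
  obtain ⟨a₀⟩ := ‹Nonempty α›
  have hpos : ∀ s : Finset ι, 0 < (partialTransversals C conf a₀ s).card := by
    intro s
    induction s using Finset.induction_on with
    | empty =>
      refine Finset.card_pos.2 ⟨fun _ => a₀, mem_partialTransversals.2 ?_⟩
      simp
    | insert i s hi ih =>
      have h1 := card_partialTransversals_insert hsymm (a₀ := a₀) hD hcard hconf s i hi
      have h2 : 0 < (C i).card * (partialTransversals C conf a₀ s).card :=
        Nat.mul_pos (by have := hcard i; omega) ih
      omega
  obtain ⟨f, hf⟩ := Finset.card_pos.1 (hpos Finset.univ)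
  obtain ⟨h1, -, h3⟩ := mem_partialTransversals.1 hf
  exact ⟨f, fun i => h1 i (Finset.mem_univ i), fun i j hij =>
    h3 i (Finset.mem_univ i) j (Finset.mem_univ j) hij⟩

end Transversal

/-! ### Gathering information in the LOCAL model -/

/-- What a node has learnt: its own identifier, the identifiers of the nodes with advice `1`
that it has heard of, and the edges that it has heard of. -/
structure LocalView where
  ident : ℕ
  marks : Set ℕ
  edges : Set (ℕ × ℕ)

/-- The algorithm that collects all information about the ball of radius `T` and then decides. -/
def gatherAlgorithm {Out : Type} (T : ℕ) (F : LocalView → Out) : LocalAlgorithm Out where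
  State := LocalView
  Msg := LocalView
  rounds := T
  init i := ⟨i.ident, {x | x = i.ident ∧ i.advice = [true]}, ∅⟩
  send s := s
  receive s m := ⟨s.ident, s.marks ∪ {x | ∃ t ∈ m, x ∈ t.marks},
    s.edges ∪ {e | ∃ t ∈ m, e ∈ t.edges ∨ e = (s.ident, t.ident)}⟩
  output := F

/-- The information that a node can collect in `t` rounds. -/
def Network.view (N : Network) (S : Set N.V) (t : ℕ) (v : N.V) : LocalView where
  ident := N.ident v
  marks := {i | ∃ u ∈ N.graph.cball v t, u ∈ S ∧ i = N.ident u}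
  edges := {e | ∃ k < t, ∃ x ∈ N.graph.cball v k, ∃ y, N.graph.Adj x y ∧
    e = (N.ident x, N.ident y)}

/-- The ball of radius `t + 1` is the union of the balls of radius `t` around the node and its
neighbours. Only the advice `[true]` is recognised, so `[]` and `[false]` act alike and one
algorithm serves both kinds of schema. -/
theorem gatherAlgorithm_state {Out : Type} (T : ℕ) (F : LocalView → Out) (N : Network)
    (l : N.V → List Bool) (S : Set N.V) (hS : ∀ v, l v = [true] ↔ v ∈ S) (t : ℕ) (v : N.V) :
    (gatherAlgorithm T F).state N l t v = N.view S t v := by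
  classical
  induction t generalizing v with
  | zero =>
    simp only [LocalAlgorithm.state, gatherAlgorithm, LocalAlgorithm.localInput, Network.view,
      SimpleGraph.cball_zero, hS]
    congr 1
    · ext i; simp [and_comm]
    · ext e; simp
  | succ t ih =>
    have hadj : ∀ w, w ∈ N.neighbors v ↔ N.graph.Adj v w := fun w => by
      simp [Network.neighbors]
    simp only [LocalAlgorithm.state, ih]
    simp only [gatherAlgorithm, Network.view, Multiset.mem_map, Finset.mem_val, hadj]
    congr 1
    · ext i
      simp only [Set.mem_union, Set.mem_ofPred_eq, SimpleGraph.mem_cball_succ']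
      constructor
      · rintro (⟨u, hu, h⟩ | ⟨_, ⟨w, hw, rfl⟩, u, hu, h⟩)
        · exact ⟨u, .inl hu, h⟩
        · exact ⟨u, .inr ⟨w, hw, hu⟩, h⟩
      · rintro ⟨u, hu | ⟨w, hw, hu⟩, h⟩
        · exact .inl ⟨u, hu, h⟩
        · exact .inr ⟨_, ⟨w, hw, rfl⟩, u, hu, h⟩
    · ext e
      simp only [Set.mem_union, Set.mem_ofPred_eq]
      constructor
      · rintro (⟨k, hk, h⟩ | ⟨_, ⟨w, hw, rfl⟩, ⟨k, hk, x, hx, h⟩ | rfl⟩)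
        · exact ⟨k, hk.trans t.lt_succ_self, h⟩
        · exact ⟨k + 1, Nat.succ_lt_succ hk, x, SimpleGraph.mem_cball_succ'.2 (.inr ⟨w, hw, hx⟩), h⟩
        · exact ⟨0, t.succ_pos, v, SimpleGraph.mem_cball_self, w, hw, rfl⟩
      · rintro ⟨k, hk, x, hx, y, hxy, rfl⟩
        cases k with
        | zero =>
          rw [SimpleGraph.cball_zero, Set.mem_singleton_iff] at hx
          subst hx
          exact .inr ⟨_, ⟨y, hxy, rfl⟩, .inr rfl⟩
        | succ k =>
          rcases SimpleGraph.mem_cball_succ'.1 hx with hx | ⟨w, hw, hx⟩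
          · exact .inl ⟨k, by omega, x, hx, y, hxy, rfl⟩
          · exact .inr ⟨_, ⟨w, hw, rfl⟩, .inl ⟨k, by omega, x, hx, y, hxy, rfl⟩⟩

theorem gatherAlgorithm_run {Out : Type} (T : ℕ) (F : LocalView → Out) (N : Network)
    (l : N.V → List Bool) (S : Set N.V) (hS : ∀ v, l v = [true] ↔ v ∈ S) (v : N.V) :
    (gatherAlgorithm T F).run N l v = F (N.view S T v) := by
  rw [← gatherAlgorithm_state T F N l S hS T v]
  rfl

/-! ### Pairings and the decomposition into trails -/

/-- Every finite set can be paired up, with at most one element left over. -/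
theorem exists_pairing (s : Set ℕ) : ∃ p : ℕ → ℕ, Function.Involutive p ∧ (∀ x ∈ s, p x ∈ s) ∧
    (∀ x, x ∉ s → p x = x) ∧ (s.Finite → ∀ x ∈ s, ∀ y ∈ s, p x = x → p y = y → x = y) := by
  classical
  by_cases hs : s.Finite
  · induction s, hs using Set.Finite.induction_on with
    | empty => exact ⟨id, fun _ => rfl, by simp, by simp, by simp⟩
    | @insert a s ha hs ih =>
      obtain ⟨p, h1, h2, h3, h4⟩ := ih
      have hpa := h3 a ha
      -- The new element is matched with the leftover one if there is one, and otherwise becomes the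
      -- leftover.
      by_cases hb : ∃ b ∈ s, p b = b
      · obtain ⟨b, hbs, hb⟩ := hb
        have hab : a ≠ b := fun h => ha (h ▸ hbs)
        have hne : ∀ x, x ≠ a → x ≠ b → p x ≠ a ∧ p x ≠ b := fun x hxa hxb =>
          ⟨fun h => hxa (h1.injective (h.trans hpa.symm)),
            fun h => hxb (h1.injective (h.trans hb.symm))⟩
        refine ⟨fun x => if x = a then b else if x = b then a else p x, fun x => ?_,
          fun x hx => ?_, fun x hx => ?_, fun _ x hx y hy hpx hpy => ?_⟩
        · by_cases hxa : x = a
          · simp [hxa, hab.symm]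
          · by_cases hxb : x = b
            · simp [hxb, hab.symm]
            · simp [hxa, hxb, hne x hxa hxb, h1 x]
        · by_cases hxa : x = a
          · simp [hxa, hbs]
          · by_cases hxb : x = b
            · simp [hxb, hab.symm]
            · simpa [hxa, hxb] using .inr (h2 x (hx.resolve_left hxa))
        · rw [Set.mem_insert_iff, not_or] at hx
          have hxb : x ≠ b := fun h => hx.2 (h ▸ hbs)
          simpa [hx.1, hxb] using h3 x hx.2
        · have key : ∀ z ∈ insert a s,
              (if z = a then b else if z = b then a else p z) ≠ z := by
            intro z hz h
            by_cases hza : z = a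
            · simp [hza, hab.symm] at h
            · by_cases hzb : z = b
              · simp [hzb, hab.symm, hab] at h
              · simp only [hza, hzb, if_false] at h
                exact hzb (h4 hs z (hz.resolve_left hza) b hbs h hb)
          exact absurd hpx (key x hx)
      · refine ⟨p, h1, fun x hx => ?_, fun x hx => h3 x fun h => hx (.inr h),
          fun _ x hx y hy hpx hpy => ?_⟩
        · rcases hx with rfl | hx
          · exact .inl hpa
          · exact .inr (h2 x hx)
        · have key : ∀ z ∈ insert a s, p z = z → z = a := fun z hz h =>
            hz.resolve_right fun hzs => hb ⟨z, hzs, h⟩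
          rw [key x hx hpx, key y hy hpy]
  · exact ⟨id, fun _ => rfl, by simp, by simp, fun h => absurd h hs⟩

/-- The partner of an element in a fixed pairing of a set. -/
noncomputable def partner (s : Set ℕ) : ℕ → ℕ := (exists_pairing s).choose

theorem partner_partner (s : Set ℕ) (x : ℕ) : partner s (partner s x) = x :=
  (exists_pairing s).choose_spec.1 x

theorem partner_mem {s : Set ℕ} {x : ℕ} (hx : x ∈ s) : partner s x ∈ s :=
  (exists_pairing s).choose_spec.2.1 x hx

theorem partner_of_notMem {s : Set ℕ} {x : ℕ} (hx : x ∉ s) : partner s x = x :=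
  (exists_pairing s).choose_spec.2.2.1 x hx

theorem eq_of_partner_eq_self {s : Set ℕ} (hs : s.Finite) {x y : ℕ} (hx : x ∈ s) (hy : y ∈ s)
    (hpx : partner s x = x) (hpy : partner s y = y) : x = y :=
  (exists_pairing s).choose_spec.2.2.2 hs x hx y hy hpx hpy

open scoped Classical in
/-- The directed edge that follows a directed edge on its trail.  The last edge of a trail is
followed by itself. -/
noncomputable def trailStep (H : SimpleGraph ℕ) (d : ℕ × ℕ) : ℕ × ℕ :=
  if partner (H.neighborSet d.2) d.1 = d.1 then d else (d.2, partner (H.neighborSet d.2) d.1)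

section TrailGraph

variable {H H' : SimpleGraph ℕ} {d e : ℕ × ℕ}

theorem trailStep_of_ne (h : partner (H.neighborSet d.2) d.1 ≠ d.1) :
    trailStep H d = (d.2, partner (H.neighborSet d.2) d.1) := if_neg h

theorem partner_ne_of_trailStep_ne (h : trailStep H d ≠ d) :
    partner (H.neighborSet d.2) d.1 ≠ d.1 := fun hp => h (if_pos hp)

theorem adj_of_trailStep_ne (h : trailStep H d ≠ d) : H.Adj d.1 d.2 := by
  by_contra hadj
  exact partner_ne_of_trailStep_ne h (partner_of_notMem fun hm => hadj (H.adj_symm hm))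

/-- Pairing is an involution, so a trail can be walked backwards by reversing its edges. This makes
`trailStep` injective away from its fixed points. -/
theorem trailStep_swap_trailStep_swap (h : trailStep H d ≠ d) :
    trailStep H (trailStep H d).swap = d.swap := by
  have hp := partner_ne_of_trailStep_ne h
  rw [trailStep_of_ne hp, Prod.swap_prod_mk, trailStep_of_ne]
  · simp only [partner_partner]; rfl
  · simp only [partner_partner]
    exact hp.symm

theorem adj_trailStep (h : H.Adj d.1 d.2) : H.Adj (trailStep H d).1 (trailStep H d).2 := by
  by_cases hp : trailStep H d = d
  · rwa [hp]
  · rw [trailStep_of_ne (partner_ne_of_trailStep_ne hp)]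
    exact partner_mem (s := H.neighborSet d.2) (H.adj_symm h)

theorem trailStep_ne_swap (h : H.Adj d.1 d.2) : trailStep H d ≠ d.swap := by
  intro h1
  by_cases hp : trailStep H d = d
  · rw [hp] at h1
    exact h.ne (congrArg Prod.fst h1)
  · rw [trailStep_of_ne (partner_ne_of_trailStep_ne hp)] at h1
    exact partner_ne_of_trailStep_ne hp (congrArg Prod.snd h1)

/-- The graph in which every directed edge is adjacent to the next one on its trail. -/
def trailGraph (H : SimpleGraph ℕ) : SimpleGraph (ℕ × ℕ) :=
  SimpleGraph.fromRel fun d e => e = trailStep H d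

theorem trailGraph_adj :
    (trailGraph H).Adj d e ↔ d ≠ e ∧ (e = trailStep H d ∨ d = trailStep H e) :=
  SimpleGraph.fromRel_adj _ _ _

theorem eq_trailStep_iff_swap (hne : d ≠ e) :
    d = trailStep H e ↔ e.swap = trailStep H d.swap := by
  constructor
  · intro h
    rw [h, trailStep_swap_trailStep_swap (h ▸ hne)]
  · intro h
    have h1 : trailStep H d.swap ≠ d.swap := by
      rw [← h]; exact fun h' => hne (Prod.swap_injective h').symm
    have h2 := trailStep_swap_trailStep_swap h1
    rw [← h, Prod.swap_swap, Prod.swap_swap] at h2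
    exact h2.symm

theorem trailGraph_adj_swap (h : (trailGraph H).Adj d e) :
    (trailGraph H).Adj d.swap e.swap := by
  rw [trailGraph_adj] at *
  obtain ⟨hne, h⟩ := h
  refine ⟨fun h' => hne (Prod.swap_injective h'), ?_⟩
  rcases h with h | h
  · right
    rwa [eq_trailStep_iff_swap hne.symm] at h
  · left
    rwa [eq_trailStep_iff_swap hne] at h

theorem adj_of_trailGraph_adj (h : (trailGraph H).Adj d e) :
    H.Adj d.1 d.2 ∧ H.Adj e.1 e.2 ∧ H.Adj d.1 e.1 := by
  have key : ∀ {d e : ℕ × ℕ}, d ≠ e → e = trailStep H d →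
      H.Adj d.1 d.2 ∧ H.Adj e.1 e.2 ∧ H.Adj d.1 e.1 := by
    rintro d e hne rfl
    have h1 := adj_of_trailStep_ne hne.symm
    refine ⟨h1, adj_trailStep h1, ?_⟩
    rw [trailStep_of_ne (partner_ne_of_trailStep_ne hne.symm)]
    exact h1
  rw [trailGraph_adj] at h
  rcases h.2 with h2 | h2
  · exact key h.1 h2
  · obtain ⟨h3, h4, h5⟩ := key h.1.symm h2
    exact ⟨h4, h3, h5.symm⟩

/-- A step forward is decided at the head of `d`. A step backward is a step forward of the reversal,
hence decided at the tail. -/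
theorem trailGraph_adj_congr (h1 : H.neighborSet d.1 = H'.neighborSet d.1)
    (h2 : H.neighborSet d.2 = H'.neighborSet d.2) :
    (trailGraph H).Adj d e ↔ (trailGraph H').Adj d e := by
  rw [trailGraph_adj, trailGraph_adj]
  refine and_congr_right fun hne => ?_
  rw [eq_trailStep_iff_swap hne, eq_trailStep_iff_swap hne]
  simp only [trailStep, Prod.fst_swap, Prod.snd_swap, h1, h2]

theorem trailGraph_adj_of_reachable (h : (trailGraph H).Reachable d e) (hd : H.Adj d.1 d.2) :
    H.Adj e.1 e.2 := by
  obtain ⟨p⟩ := h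
  induction p with
  | nil => exact hd
  | cons h _ ih => exact ih (adj_of_trailGraph_adj h).2.1

theorem fst_mem_cball {k : ℕ} (h : e ∈ (trailGraph H).cball d k) : e.1 ∈ H.cball d.1 k :=
  SimpleGraph.map_mem_cball (f := Prod.fst) (fun _ _ h => (adj_of_trailGraph_adj h).2.2) h

theorem swap_mem_cball {k : ℕ} (h : e ∈ (trailGraph H).cball d k) :
    e.swap ∈ (trailGraph H).cball d.swap k :=
  SimpleGraph.map_mem_cball (f := Prod.swap) (fun _ _ h => trailGraph_adj_swap h) h

theorem snd_mem_cball {k : ℕ} (h : e ∈ (trailGraph H).cball d k) : e.2 ∈ H.cball d.2 k :=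
  fst_mem_cball (swap_mem_cball h)

theorem trailStep_injective_of_ne {a b : ℕ × ℕ} (ha : trailStep H a ≠ a) (hb : trailStep H b ≠ b)
    (h : trailStep H a = trailStep H b) : a = b := by
  have h1 := trailStep_swap_trailStep_swap ha
  rw [h, trailStep_swap_trailStep_swap hb] at h1
  exact (Prod.swap_injective h1).symm

/-- By injectivity of the step away from fixed points, components are single orbits: paths or cycles
without branching. -/
theorem exists_iterate_of_reachable (h : (trailGraph H).Reachable d e) :
    ∃ k, (trailStep H)^[k] d = e ∨ (trailStep H)^[k] e = d := by
  have key : ∀ {d e f : ℕ × ℕ}, (∃ k, (trailStep H)^[k] d = e) → f ≠ e → e = trailStep H f →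
      ∃ k, (trailStep H)^[k] d = f ∨ (trailStep H)^[k] f = d := by
    rintro d e f ⟨k, hk⟩ hne hf
    induction k with
    | zero =>
      rw [Function.iterate_zero_apply] at hk
      exact ⟨1, .inr (by rw [Function.iterate_one, ← hf, hk])⟩
    | succ k ih =>
      by_cases hk' : (trailStep H)^[k] d = e
      · exact ih hk'
      · rw [Function.iterate_succ_apply'] at hk
        refine ⟨k, .inl (trailStep_injective_of_ne (H := H) ?_ ?_ (hk.trans hf))⟩
        · rw [hk]; exact Ne.symm hk'
        · rw [← hf]; exact hne.symm
  obtain ⟨p⟩ := h.symm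
  induction p with
  | nil => exact ⟨0, .inl rfl⟩
  | @cons f e' d hadj p ih =>
    rw [trailGraph_adj] at hadj
    obtain ⟨hne, hstep⟩ := hadj
    obtain ⟨k, hk | hk⟩ := ih ⟨p.reverse⟩
    · rcases hstep with hstep | hstep
      · exact key ⟨k, hk⟩ hne hstep
      · exact ⟨k + 1, .inl (by rw [Function.iterate_succ_apply', hk, hstep])⟩
    · rcases hstep with hstep | hstep
      · exact ⟨k + 1, .inr (by rw [Function.iterate_succ_apply, ← hstep, hk])⟩
      · cases k with
        | zero => exact ⟨1, .inl (by rw [hstep, ← hk]; rfl)⟩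
        | succ k => exact ⟨k, .inr (by rw [hstep, ← hk, Function.iterate_succ_apply])⟩

/-- A trail from `d` to its reversal would be a palindrome. Removing one step at both ends shortens
it until its centre is an edge equal to its own reversal or followed by it; neither happens, as
there are no loops and a nontrivial step has a partner different from the edge. -/
theorem iterate_trailStep_ne_swap (k : ℕ) :
    ∀ d, H.Adj d.1 d.2 → (trailStep H)^[k] d ≠ d.swap := by
  induction k using Nat.strong_induction_on with
  | _ k ih =>
  intro d hd h
  match k with
  | 0 => exact hd.ne (congrArg Prod.fst h)
  | 1 => exact trailStep_ne_swap hd h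
  | k + 2 =>
    by_cases h0 : trailStep H d = d
    · rw [Function.iterate_fixed h0] at h
      exact hd.ne (congrArg Prod.fst h)
    rw [Function.iterate_succ_apply'] at h
    by_cases h1 : (trailStep H)^[k + 1] d = d.swap
    · exact ih (k + 1) (by omega) d hd h1
    · refine ih k (by omega) (trailStep H d) (adj_trailStep hd) ?_
      rw [← Function.iterate_succ_apply]
      have h2 := trailStep_swap_trailStep_swap (d := (trailStep H)^[k + 1] d) (H := H)
        (by rw [h]; exact Ne.symm h1)
      refine trailStep_injective_of_ne (H := H) ?_ ?_ ?_
      · rw [h]; exact Ne.symm h1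
      · rw [trailStep_swap_trailStep_swap h0]
        exact fun h' => h0 (Prod.swap_injective h').symm
      · rw [h, trailStep_swap_trailStep_swap h0]

/-- A trail does not traverse an edge in both directions. -/
theorem not_reachable_swap (hd : H.Adj d.1 d.2) : ¬ (trailGraph H).Reachable d d.swap := by
  intro h
  obtain ⟨k, hk | hk⟩ := exists_iterate_of_reachable h
  · exact iterate_trailStep_ne_swap k d hd hk
  · exact iterate_trailStep_ne_swap k d.swap hd.symm (by rw [hk, Prod.swap_swap])

end TrailGraph

/-! ### The canonical direction of a trail -/

/-- A rule choosing between a set of directed edges and its reversal. -/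
def Preferred (C : Set (ℕ × ℕ)) : Prop :=
  sInf ((fun e => Nat.pair e.1 e.2) '' (C ∪ Prod.swap '' C)) ∈
    (fun e : ℕ × ℕ => Nat.pair e.1 e.2) '' C

/-- The least code in the union belongs to exactly one of two disjoint sets, by injectivity of the
coding. -/
theorem preferred_swap {C : Set (ℕ × ℕ)} (hne : C.Nonempty)
    (hdisj : ∀ d ∈ C, d.swap ∉ C) : Preferred (Prod.swap '' C) ↔ ¬ Preferred C := by
  have hinj : Function.Injective fun e : ℕ × ℕ => Nat.pair e.1 e.2 := fun a b h => by
    have := Nat.pair_eq_pair.1 h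
    exact Prod.ext this.1 this.2
  have hss : Prod.swap '' (Prod.swap '' C) = C := by
    rw [← Set.image_comp, Prod.swap_swap_eq, Set.image_id]
  unfold Preferred
  rw [hss, Set.union_comm]
  obtain ⟨c, hc⟩ := hne
  have hmem := Nat.sInf_mem (s := (fun e : ℕ × ℕ => Nat.pair e.1 e.2) '' (C ∪ Prod.swap '' C))
    ⟨_, c, .inl hc, rfl⟩
  generalize sInf ((fun e : ℕ × ℕ => Nat.pair e.1 e.2) '' (C ∪ Prod.swap '' C)) = n at *
  constructor
  · rintro ⟨_, ⟨a, ha, rfl⟩, rfl⟩ ⟨b, hb, hab⟩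
    have := hinj hab
    subst this
    exact hdisj a ha hb
  · intro h
    rw [Set.image_union] at hmem
    exact hmem.resolve_left h

section TrailDirection

variable {H H' : SimpleGraph ℕ} {d e : ℕ × ℕ}

/-- The trail of a directed edge, traversed in the direction of that edge. -/
def trailOf (H : SimpleGraph ℕ) (d : ℕ × ℕ) : Set (ℕ × ℕ) := {e | (trailGraph H).Reachable d e}

theorem trailOf_eq (h : (trailGraph H).Reachable d e) : trailOf H d = trailOf H e :=
  Set.ext fun _ => ⟨fun h' => h.symm.trans h', fun h' => h.trans h'⟩

theorem reachable_swap (h : (trailGraph H).Reachable d e) :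
    (trailGraph H).Reachable d.swap e.swap := by
  obtain ⟨k, hk⟩ := SimpleGraph.exists_mem_cball_of_reachable h
  exact SimpleGraph.reachable_of_mem_cball (swap_mem_cball hk)

theorem trailOf_swap : trailOf H d.swap = Prod.swap '' trailOf H d := by
  ext e
  rw [Set.image_swap_eq_preimage_swap]
  refine ⟨fun h => ?_, fun h => ?_⟩
  · have := reachable_swap h
    rwa [Prod.swap_swap] at this
  · have := reachable_swap (e := e.swap) h
    rwa [Prod.swap_swap] at this

/-- The orientation of the edges: each trail is traversed in its preferred direction. -/
def TrailDir (H : SimpleGraph ℕ) (d : ℕ × ℕ) : Prop := H.Adj d.1 d.2 ∧ Preferred (trailOf H d)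

theorem trailDir_swap (hd : H.Adj d.1 d.2) : TrailDir H d.swap ↔ ¬ TrailDir H d := by
  have h1 : Preferred (Prod.swap '' trailOf H d) ↔ ¬ Preferred (trailOf H d) := by
    refine preferred_swap ⟨d, .refl d⟩ fun e he hes => ?_
    exact not_reachable_swap (trailGraph_adj_of_reachable he hd)
      ((SimpleGraph.Reachable.symm he).trans hes)
  rw [TrailDir, TrailDir, trailOf_swap, h1]
  exact ⟨fun h h' => h.2 h'.2, fun h => ⟨hd.symm, fun h' => h ⟨hd, h'⟩⟩⟩

theorem trailDir_congr (h : (trailGraph H).Reachable d e) : TrailDir H d ↔ TrailDir H e := by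
  rw [TrailDir, TrailDir, trailOf_eq h]
  exact and_congr_left fun _ => ⟨fun hd => trailGraph_adj_of_reachable h hd,
    fun he => trailGraph_adj_of_reachable h.symm he⟩

theorem trailDir_partner {a v : ℕ} (hp : partner (H.neighborSet v) a ≠ a) :
    TrailDir H (a, v) ↔ TrailDir H (v, partner (H.neighborSet v) a) := by
  have h := trailStep_of_ne (H := H) (d := (a, v)) hp
  rw [← show trailStep H (a, v) = (v, partner (H.neighborSet v) a) from h]
  by_cases hd : (a, v) = trailStep H (a, v)
  · rw [← hd]
  · exact trailDir_congr (SimpleGraph.Adj.reachable (trailGraph_adj.2 ⟨hd, .inl rfl⟩))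

/-- At most one element of `A` is unpaired; `partner N` injects the others into `B`. -/
theorem ncard_le_ncard_add_one {N A B : Set ℕ} (hN : N.Finite) (hA : A ⊆ N) (hB : B ⊆ N)
    (h : ∀ a ∈ A, partner N a ≠ a → partner N a ∈ B) : A.ncard ≤ B.ncard + 1 := by
  have hsplit := Set.ncard_inter_add_ncard_sdiff_eq_ncard A {a | partner N a = a}
    (hN.subset hA)
  have h1 : (A ∩ {a | partner N a = a}).ncard ≤ 1 :=
    (Set.ncard_le_one ((hN.subset hA).subset Set.inter_subset_left)).2 fun a ha b hb =>
      eq_of_partner_eq_self hN (hA ha.1) (hA hb.1) ha.2 hb.2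
  have h2 : (A \ {a | partner N a = a}).ncard ≤ B.ncard :=
    Set.ncard_le_ncard_of_injOn (partner N) (fun a ha => h a ha.1 ha.2)
      (fun a _ b _ hab => by rw [← partner_partner N a, hab, partner_partner])
      (hN.subset hB)
  omega

/-- A trail entering along a paired edge leaves along its partner and conversely, so only the
leftover edge can contribute to the imbalance. -/
theorem trailDir_balanced {v : ℕ} (hfin : (H.neighborSet v).Finite) :
    |({u | TrailDir H (u, v)}.ncard : ℤ) - ({u | TrailDir H (v, u)}.ncard : ℤ)| ≤ 1 := by
  have hin : {u | TrailDir H (u, v)} ⊆ H.neighborSet v := fun u hu => H.adj_symm hu.1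
  have hout : {u | TrailDir H (v, u)} ⊆ H.neighborSet v := fun u hu => hu.1
  have h1 := ncard_le_ncard_add_one hfin hin hout fun a ha hp => (trailDir_partner hp).1 ha
  have h2 := ncard_le_ncard_add_one hfin hout hin fun a ha hp => by
    have := trailDir_partner (H := H) (v := v) (a := partner (H.neighborSet v) a)
      (by rw [partner_partner]; exact hp.symm)
    rw [partner_partner] at this
    exact this.2 ha
  rw [abs_le]
  omega

/-! ### Well-separated marks on long trails -/

theorem ncard_darts_le {Δ : ℕ}
    (h : ∀ x, (H.neighborSet x).Finite ∧ (H.neighborSet x).ncard ≤ Δ) (u R : ℕ) :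
    {e : ℕ × ℕ | H.Adj e.1 e.2 ∧ e.1 ∈ H.cball u R}.Finite ∧
      {e : ℕ × ℕ | H.Adj e.1 e.2 ∧ e.1 ∈ H.cball u R}.ncard ≤ (Δ + 1) ^ (R + 1) := by
  classical
  obtain ⟨hf, hc⟩ := SimpleGraph.finite_cball_and_ncard_le h u R
  have heq : {e : ℕ × ℕ | H.Adj e.1 e.2 ∧ e.1 ∈ H.cball u R} =
      ↑(hf.toFinset.biUnion fun x => (h x).1.toFinset.image fun y => (x, y)) := by
    ext ⟨x, y⟩
    simp [and_comm]
  rw [heq, Set.ncard_coe_finset]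
  refine ⟨Finset.finite_toSet _, ?_⟩
  have h1 := Finset.card_biUnion_le_card_mul hf.toFinset
    (fun x => (h x).1.toFinset.image fun y => (x, y)) (Δ + 1) fun x _ => by
      refine Finset.card_image_le.trans ?_
      rw [← Set.ncard_eq_toFinset_card _ (h x).1]
      exact (h x).2.trans Δ.le_succ
  rw [← Set.ncard_eq_toFinset_card _ hf] at h1
  exact h1.trans (Nat.mul_le_mul_right _ hc)

theorem exists_maximal_disjoint {α β : Type*} {L : Set α} (hL : L.Finite) (B : α → Set β) :
    ∃ I : Finset α, ↑I ⊆ L ∧ (∀ i ∈ I, ∀ j ∈ I, i ≠ j → Disjoint (B i) (B j)) ∧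
      ∀ d ∈ L, (B d).Nonempty → ∃ i ∈ I, ¬ Disjoint (B d) (B i) := by
  classical
  obtain ⟨I, hI, hmax⟩ := Finset.exists_max_image
    (hL.toFinset.powerset.filter fun I : Finset α => (I : Set α).PairwiseDisjoint B)
    Finset.card ⟨∅, by simp⟩
  rw [Finset.mem_filter, Finset.mem_powerset] at hI
  refine ⟨I, fun i hi => hL.mem_toFinset.1 (hI.1 hi),
    fun i hi j hj hij => hI.2 hi hj hij, fun d hd hne => ?_⟩
  by_contra! hcon
  have hdI : d ∉ I := fun h => hne.ne_empty (disjoint_self.1 (hcon d h))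
  have := hmax (insert d I) (by
    rw [Finset.mem_filter, Finset.mem_powerset]
    refine ⟨Finset.insert_subset (hL.mem_toFinset.2 hd) hI.1, fun i hi j hj hij => ?_⟩
    rcases Finset.mem_insert.1 (Finset.mem_coe.1 hi) with hid | hi <;>
      rcases Finset.mem_insert.1 (Finset.mem_coe.1 hj) with hjd | hj
    · exact absurd (hid.trans hjd.symm) hij
    · rw [hid]; exact hcon j hj
    · rw [hjd]; exact (hcon i hi).symm
    · exact hI.2 hi hj hij)
  rw [Finset.card_insert_of_notMem hdI] at this
  omega

/-- Well-separated directed edges, oriented correctly, such that each long trail comes across one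
of them within a bounded number of steps. -/
theorem exists_marks {Δ : ℕ}
    (h : ∀ x, (H.neighborSet x).Finite ∧ (H.neighborSet x).ncard ≤ Δ)
    (hfin : {e : ℕ × ℕ | H.Adj e.1 e.2}.Finite) (R : ℕ) {l : ℕ}
    (hl : 4 * (Δ + 1) ^ (R + 1) ≤ l) :
    ∃ M : Set (ℕ × ℕ), (∀ m ∈ M, TrailDir H m) ∧
      (∀ m ∈ M, ∀ m' ∈ M, m'.1 ∈ H.cball m.1 R → m = m') ∧
      (∀ m ∈ M, ∃ x, H.Reachable m.1 x ∧ x ∉ H.cball m.1 R) ∧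
      ∀ d, TrailDir H d → ¬ trailOf H d ⊆ (trailGraph H).cball d l →
        ∃ m ∈ M, m ∈ (trailGraph H).cball d (3 * l) := by
  classical
  have hballdart : ∀ {d : ℕ × ℕ} {k}, H.Adj d.1 d.2 →
      (trailGraph H).cball d k ⊆ {e : ℕ × ℕ | H.Adj e.1 e.2} := fun hd e he =>
    trailGraph_adj_of_reachable (SimpleGraph.reachable_of_mem_cball he) hd
  obtain ⟨I, hIL, hdisj, hmax⟩ := exists_maximal_disjoint
    (L := {d | TrailDir H d ∧ ¬ trailOf H d ⊆ (trailGraph H).cball d l})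
    (hfin.subset fun d hd => hd.1.1) fun d => (trailGraph H).cball d l
  have hIfin : ∀ i : I, ((trailGraph H).cball i.1 l).Finite := fun i =>
    hfin.subset (hballdart (hIL i.2).1.1)
  have hIcard : ∀ i : I, l < ((trailGraph H).cball i.1 l).ncard := fun i => by
    obtain ⟨e, he, hel⟩ := Set.not_subset.1 (hIL i.2).2
    exact SimpleGraph.lt_ncard_cball (hIfin i) he (le_of_not_ge hel)
  have hconf : ∀ x : ℕ × ℕ, {p : I × (ℕ × ℕ) | p.2 ∈ (hIfin p.1).toFinset ∧
      p.2.1 ∈ H.cball x.1 R}.ncard ≤ (Δ + 1) ^ (R + 1) := by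
    intro x
    obtain ⟨hf, hc⟩ := ncard_darts_le h x.1 R
    refine (Set.ncard_le_ncard_of_injOn Prod.snd ?_ ?_ hf).trans hc
    · rintro ⟨i, e⟩ ⟨h1, h2⟩
      exact ⟨hballdart (hIL i.2).1.1 ((hIfin i).mem_toFinset.1 h1), h2⟩
    -- The segments are disjoint, so a directed edge determines the segment containing it and
    -- conflicts are counted by directed edges alone.
    · rintro ⟨i, e⟩ ⟨h1, -⟩ ⟨j, e'⟩ ⟨h2, -⟩ hee
      obtain rfl : e = e' := hee
      by_cases hij : i = j
      · rw [hij]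
      · exact absurd ((hIfin j).mem_toFinset.1 h2) (Set.disjoint_left.1
          (hdisj i.1 i.2 j.1 j.2 fun h => hij (Subtype.ext h)) ((hIfin i).mem_toFinset.1 h1))
  obtain ⟨f, hfC, hfind⟩ := exists_independent_transversal
    (C := fun i : I => (hIfin i).toFinset) (conf := fun x y => y.1 ∈ H.cball x.1 R)
    (fun x y hxy => SimpleGraph.mem_cball_comm.1 hxy) (D := (Δ + 1) ^ (R + 1))
    (Nat.pow_pos Δ.succ_pos) (fun i => by
      rw [← Set.ncard_eq_toFinset_card _ (hIfin i)]
      exact hl.trans (hIcard i).le) hconf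
  have hfball : ∀ i : I, f i ∈ (trailGraph H).cball i.1 l := fun i =>
    (hIfin i).mem_toFinset.1 (hfC i)
  refine ⟨Set.range f, ?_, ?_, ?_, fun d hd hlong => ?_⟩
  · rintro _ ⟨i, rfl⟩
    exact (trailDir_congr (SimpleGraph.reachable_of_mem_cball (hfball i))).1 (hIL i.2).1
  · rintro _ ⟨i, rfl⟩ _ ⟨j, rfl⟩ hij
    by_contra hne
    exact hfind i j (fun h => hne (h ▸ rfl)) hij
  -- If the component lay within distance `R`, it would have too few directed edges to contain the
  -- segment.
  · rintro _ ⟨i, rfl⟩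
    by_contra! hcon
    obtain ⟨hf, hc⟩ := ncard_darts_le h (f i).1 R
    have hsub : (trailGraph H).cball i.1 l ⊆
        {e : ℕ × ℕ | H.Adj e.1 e.2 ∧ e.1 ∈ H.cball (f i).1 R} := fun e he => by
      refine ⟨hballdart (hIL i.2).1.1 he, hcon e.1 ?_⟩
      exact (SimpleGraph.reachable_of_mem_cball (fst_mem_cball (hfball i))).symm.trans
        (SimpleGraph.reachable_of_mem_cball (fst_mem_cball he))
    have h1 := Set.ncard_le_ncard hsub hf
    have h2 := hIcard i
    omega
  -- By maximality the segment of `d` meets a chosen one: `l` steps to a common edge, `l` to the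
  -- centre `i`, `l` to the mark.
  · obtain ⟨i, hi, hmeet⟩ := hmax d ⟨hd, hlong⟩ ⟨d, SimpleGraph.mem_cball_self⟩
    obtain ⟨e, he1, he2⟩ := Set.not_disjoint_iff.1 hmeet
    refine ⟨f ⟨i, hi⟩, ⟨_, rfl⟩, ?_⟩
    have h1 := SimpleGraph.mem_cball_add (SimpleGraph.mem_cball_add he1
      (SimpleGraph.mem_cball_comm.1 he2)) (hfball ⟨i, hi⟩)
    rwa [show l + l + l = 3 * l by ring] at h1

end TrailDirection

/-! ### Writing marks as bits and reading them back -/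

section Decoding

variable {H H' : SimpleGraph ℕ} {d e : ℕ × ℕ} {M : Set (ℕ × ℕ)} {S S' : Set ℕ}

open scoped Classical in
/-- Some node at distance 3 from `u`, if there is one. -/
noncomputable def thirdNode (H : SimpleGraph ℕ) (u : ℕ) : ℕ :=
  if h : ∃ w, H.edist u w = (3 : ℕ) then h.choose else u

/-- The nodes that carry a 1 in order to mark the directed edge `m`: its endpoints and, if the edge
leads to the smaller identifier, a node at distance 3. -/
def gadget (H : SimpleGraph ℕ) (m : ℕ × ℕ) : Set ℕ :=
  {m.1, m.2} ∪ {w | m.2 < m.1 ∧ w = thirdNode H m.1}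

/-- The nodes that carry a 1. -/
def markedNodes (H : SimpleGraph ℕ) (M : Set (ℕ × ℕ)) : Set ℕ := {x | ∃ m ∈ M, x ∈ gadget H m}

/-- The directed edges that are marked by a set of nodes that carry a 1. -/
def markedEdges (H : SimpleGraph ℕ) (S : Set ℕ) : Set (ℕ × ℕ) :=
  {e | H.Adj e.1 e.2 ∧ e.1 ∈ S ∧ e.2 ∈ S ∧
    (e.1 < e.2 ↔ ¬ ∃ w ∈ S, w ∈ H.cball e.1 4 ∧ w ≠ e.1 ∧ w ≠ e.2)}

/-- The orientation that is reconstructed from the nodes that carry a 1 by following the trails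
for `r` steps. -/
def DecodedDir (H : SimpleGraph ℕ) (S : Set ℕ) (r : ℕ) (d : ℕ × ℕ) : Prop :=
  (∃ m ∈ markedEdges H S, m ∈ (trailGraph H).cball d r) ∨
    ((∀ m ∈ markedEdges H S, m ∉ (trailGraph H).cball d.swap r) ∧
      Preferred ((trailGraph H).cball d r))

theorem edist_thirdNode {u x : ℕ} {R : ℕ} (hR : 3 ≤ R) (hx : H.Reachable u x)
    (hxR : x ∉ H.cball u R) : H.edist u (thirdNode H u) = (3 : ℕ) := by
  have h : ∃ w, H.edist u w = (3 : ℕ) := by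
    obtain ⟨k, hk⟩ := SimpleGraph.exists_mem_cball_of_reachable hx
    refine SimpleGraph.exists_edist_eq hk (le_of_lt ?_)
    refine lt_of_le_of_lt ?_ (not_le.1 hxR)
    exact_mod_cast hR
  rw [thirdNode, dif_pos h]
  exact h.choose_spec

theorem finite_gadget (m : ℕ × ℕ) : (gadget H m).Finite :=
  (Set.toFinite _).union ((Set.finite_singleton (thirdNode H m.1)).subset fun _ h => h.2)

theorem ncard_gadget_le (m : ℕ × ℕ) : (gadget H m).ncard ≤ 3 := by
  refine (Set.ncard_union_le _ _).trans ?_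
  have h1 := Set.ncard_insert_le m.1 {m.2}
  have h2 : ({w | m.2 < m.1 ∧ w = thirdNode H m.1} : Set ℕ).ncard ≤ 1 := by
    rw [← Set.ncard_singleton (thirdNode H m.1)]
    exact Set.ncard_le_ncard fun _ h => h.2
  rw [Set.ncard_singleton] at h1
  omega

theorem gadget_subset_cball {m : ℕ × ℕ} (hadj : H.Adj m.1 m.2)
    (h3 : H.edist m.1 (thirdNode H m.1) = (3 : ℕ)) : gadget H m ⊆ H.cball m.1 3 := by
  rintro x ((rfl | rfl) | ⟨-, rfl⟩)
  · exact SimpleGraph.mem_cball_self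
  · exact SimpleGraph.cball_mono (by norm_num) hadj.mem_cball_one
  · exact h3.le

/-- The third node is at distance 3 from the tail, hence adjacent to neither endpoint, so the only
edge between two nodes of a gadget is the marked one. The presence of the third node then selects
one of its two directions. -/
theorem markedEdges_markedNodes {R : ℕ} (hR : 8 ≤ R) (hadj : ∀ m ∈ M, H.Adj m.1 m.2)
    (hsep : ∀ m ∈ M, ∀ m' ∈ M, m'.1 ∈ H.cball m.1 R → m = m')
    (h3 : ∀ m ∈ M, H.edist m.1 (thirdNode H m.1) = (3 : ℕ)) :
    markedEdges H (markedNodes H M) = M := by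
  have hball : ∀ m ∈ M, ∀ x ∈ gadget H m, x ∈ H.cball m.1 3 := fun m hm x hx =>
    gadget_subset_cball (hadj m hm) (h3 m hm) hx
  -- A gadget has radius 3 around its tail, so tails of gadgets sharing such a node are within `5 +
  -- 3 = 8`.
  have hclose : ∀ m ∈ M, ∀ x ∈ markedNodes H M, x ∈ H.cball m.1 5 → x ∈ gadget H m := by
    rintro m hm x ⟨m', hm', hx'⟩ hx
    have h1 := SimpleGraph.mem_cball_add hx (SimpleGraph.mem_cball_comm.1 (hball m' hm' x hx'))
    rwa [hsep m hm m' hm' (SimpleGraph.cball_mono hR h1)]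
  have hthird : ∀ m ∈ M, ∀ x ∈ H.cball m.1 2, x ≠ thirdNode H m.1 := by
    rintro m hm x hx rfl
    have h1 : H.edist m.1 (thirdNode H m.1) ≤ (2 : ℕ) := hx
    rw [h3 m hm] at h1
    exact absurd (by exact_mod_cast h1 : 3 ≤ 2) (by norm_num)
  have hone : ∀ m ∈ M, m.2 ∈ H.cball m.1 1 := fun m hm => (hadj m hm).mem_cball_one
  have hext : ∀ m ∈ M, (∃ w ∈ gadget H m, w ≠ m.1 ∧ w ≠ m.2) ↔ m.2 < m.1 := by
    intro m hm
    constructor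
    · rintro ⟨w, (h | h) | h, h1, h2⟩
      · exact absurd h h1
      · exact absurd h h2
      · exact h.1
    · intro h
      exact ⟨_, .inr ⟨h, rfl⟩, (hthird m hm _ SimpleGraph.mem_cball_self).symm,
        (hthird m hm _ (SimpleGraph.cball_mono (by norm_num) (hone m hm))).symm⟩
  have hlt : ∀ m ∈ M, (m.1 < m.2 ↔ ¬ m.2 < m.1) := fun m hm => by
    have := (hadj m hm).ne; omega
  ext ⟨u, v⟩
  constructor
  · rintro ⟨huv, ⟨m, hm, hu⟩, hv, hcond⟩
    simp only at huv hv hcond hu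
    have huball := hball m hm u hu
    have hvm : v ∈ gadget H m :=
      hclose m hm v hv (SimpleGraph.cball_mono (by norm_num)
        (SimpleGraph.mem_cball_add huball huv.mem_cball_one))
    have hnear : ∀ x y, H.Adj x y → x ∈ gadget H m → y ∈ gadget H m → x = m.1 ∨ x = m.2 := by
      rintro x y hxy ((hx | hx) | ⟨hx, rfl⟩) hy
      · exact .inl hx
      · exact .inr hx
      · exfalso
        have key : y ∈ H.cball m.1 1 → False := fun hy =>
          hthird m hm _ (SimpleGraph.mem_cball_add hy hxy.symm.mem_cball_one) rfl
        rcases hy with (rfl | rfl) | ⟨-, rfl⟩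
        · exact key SimpleGraph.mem_cball_self
        · exact key (hone m hm)
        · exact hxy.ne rfl
    have hu' := hnear u v huv hu hvm
    have hv' := hnear v u huv.symm hvm hu
    have hne := huv.ne
    rcases hu' with rfl | rfl
    · rcases hv' with rfl | rfl
      · exact absurd rfl hne
      · exact hm
    · rcases hv' with rfl | rfl
      -- The reversed edge sees the same third node, at distance at most `1 + 3 = 4` from the head,
      -- so its test has the opposite outcome.
      · exfalso
        have hiff : (∃ w ∈ markedNodes H M, w ∈ H.cball m.2 4 ∧ w ≠ m.2 ∧ w ≠ m.1) ↔
            m.2 < m.1 := by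
          rw [← hext m hm]
          constructor
          · rintro ⟨w, hw, hwb, h1, h2⟩
            exact ⟨w, hclose m hm w hw (by
              have := SimpleGraph.mem_cball_add (hone m hm) hwb
              rwa [show 1 + 4 = 5 by norm_num] at this), h2, h1⟩
          · rintro ⟨w, hw, h1, h2⟩
            exact ⟨w, ⟨m, hm, hw⟩, by
              have := SimpleGraph.mem_cball_add (hadj m hm).symm.mem_cball_one (hball m hm w hw)
              rwa [show 1 + 3 = 4 by norm_num] at this, h2, h1⟩
        rw [hiff] at hcond
        tauto
      · exact absurd rfl hne
  · intro hm
    refine ⟨hadj _ hm, ⟨_, hm, .inl (.inl rfl)⟩, ⟨_, hm, .inl (.inr rfl)⟩, ?_⟩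
    rw [hlt _ hm, ← hext _ hm]
    refine not_congr ⟨?_, ?_⟩
    · rintro ⟨w, hw, h1, h2⟩
      exact ⟨w, ⟨_, hm, hw⟩, SimpleGraph.cball_mono (by norm_num) (hball _ hm w hw), h1, h2⟩
    · rintro ⟨w, hw, hwb, h1, h2⟩
      exact ⟨w, hclose _ hm w hw (SimpleGraph.cball_mono (by norm_num) hwb), h1, h2⟩

/-- A mark within reach is always truthful, as it lies on the same trail. If the trail is exhausted
within `l` steps, the ball is the entire trail and its preference is the true one; otherwise the
correctly directed one of `d` and `d.swap` finds a mark. -/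
theorem decodedDir_iff {l r : ℕ} (hr : 3 * l ≤ r) (hM : ∀ m ∈ M, TrailDir H m)
    (hdec : markedEdges H S = M)
    (hlong : ∀ d, TrailDir H d → ¬ trailOf H d ⊆ (trailGraph H).cball d l →
        ∃ m ∈ M, m ∈ (trailGraph H).cball d (3 * l)) (hd : H.Adj d.1 d.2) :
    DecodedDir H S r d ↔ TrailDir H d := by
  rw [DecodedDir, hdec]
  have hmono : ∀ d, (trailGraph H).cball d (3 * l) ⊆ (trailGraph H).cball d r := fun d =>
    SimpleGraph.cball_mono hr
  have hshort : trailOf H d ⊆ (trailGraph H).cball d l →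
      (trailGraph H).cball d r = trailOf H d := fun h =>
    Set.Subset.antisymm (fun e he => SimpleGraph.reachable_of_mem_cball he)
      (h.trans (SimpleGraph.cball_mono (by omega)))
  have hmark : ∀ m ∈ M, ∀ d, m ∈ (trailGraph H).cball d r → TrailDir H d := fun m hm d hmd =>
    (trailDir_congr (SimpleGraph.reachable_of_mem_cball hmd)).2 (hM m hm)
  constructor
  · rintro (⟨m, hm, hmd⟩ | ⟨hno, hpref⟩)
    · exact hmark m hm d hmd
    · by_cases hs : trailOf H d ⊆ (trailGraph H).cball d l
      · rw [hshort hs] at hpref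
        exact ⟨hd, hpref⟩
      · by_contra hnd
        obtain ⟨m, hm, hmd⟩ := hlong d.swap ((trailDir_swap hd).2 hnd) fun hs' => hs fun e he => by
          have := swap_mem_cball (hs' (reachable_swap he))
          rwa [Prod.swap_swap, Prod.swap_swap] at this
        exact hno m hm (hmono _ hmd)
  · intro htd
    by_cases hs : trailOf H d ⊆ (trailGraph H).cball d l
    · refine .inr ⟨fun m hm hmd => (trailDir_swap hd).1 (hmark m hm _ hmd) htd, ?_⟩
      rw [hshort hs]
      exact htd.2
    · obtain ⟨m, hm, hmd⟩ := hlong d htd hs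
      exact .inl ⟨m, hm, hmono _ hmd⟩

/-- The reconstruction only depends on the ball of radius `r + 5`. -/
theorem decodedDir_congr {r u v : ℕ} (huv : H.Adj v u)
    (hH : ∀ k < r + 5, ∀ x ∈ H.cball v k, ∀ y, H.Adj x y ↔ H'.Adj x y)
    (hS : ∀ x ∈ H.cball v (r + 5), x ∈ S ↔ x ∈ S') :
    DecodedDir H S r (v, u) ↔ DecodedDir H' S' r (v, u) := by
  -- The radius `r + 5` is `r` trail steps, one for the head `u` of the starting edge, and 4 for the
  -- search for a third node.
  have hends : ∀ d : ℕ × ℕ, d = (v, u) ∨ d = (u, v) → ∀ k, ∀ e ∈ (trailGraph H).cball d k,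
      e.1 ∈ H.cball v (k + 1) ∧ e.2 ∈ H.cball v (k + 1) := by
    have hv : ∀ k, H.cball v k ⊆ H.cball v (k + 1) := fun k => SimpleGraph.cball_mono k.le_succ
    have hu : ∀ k, H.cball u k ⊆ H.cball v (k + 1) := fun k x hx => by
      rw [add_comm]
      exact SimpleGraph.mem_cball_add huv.mem_cball_one hx
    rintro d (rfl | rfl) k e he
    · exact ⟨hv k (fst_mem_cball he), hu k (snd_mem_cball he)⟩
    · exact ⟨hu k (fst_mem_cball he), hv k (snd_mem_cball he)⟩
  have hball : ∀ d : ℕ × ℕ, d = (v, u) ∨ d = (u, v) →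
      (trailGraph H).cball d r = (trailGraph H').cball d r := fun d hd =>
    SimpleGraph.cball_congr (r := r) (fun k hk e he e' => by
      obtain ⟨h1, h2⟩ := hends d hd k e he
      exact trailGraph_adj_congr (Set.ext fun y => hH _ (by omega) _ h1 y)
        (Set.ext fun y => hH _ (by omega) _ h2 y)) r le_rfl
  have hmarks : ∀ d : ℕ × ℕ, d = (v, u) ∨ d = (u, v) → ∀ e ∈ (trailGraph H).cball d r,
      (e ∈ markedEdges H S ↔ e ∈ markedEdges H' S') := by
    intro d hd e he
    obtain ⟨h1, h2⟩ := hends d hd r e he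
    have hb : H.cball e.1 4 = H'.cball e.1 4 :=
      SimpleGraph.cball_congr (r := 4) (fun k hk x hx y =>
        hH _ (by omega) x (SimpleGraph.mem_cball_add h1 hx) y) 4 le_rfl
    have hS1 := hS e.1 (SimpleGraph.cball_mono (by omega) h1)
    have hS2 := hS e.2 (SimpleGraph.cball_mono (by omega) h2)
    have hw : (∃ w ∈ S, w ∈ H.cball e.1 4 ∧ w ≠ e.1 ∧ w ≠ e.2) ↔
        ∃ w ∈ S', w ∈ H.cball e.1 4 ∧ w ≠ e.1 ∧ w ≠ e.2 := by
      refine exists_congr fun w => and_congr_left fun hw => hS w ?_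
      have := SimpleGraph.mem_cball_add h1 hw.1
      rwa [show r + 1 + 4 = r + 5 by omega] at this
    simp only [markedEdges, Set.mem_ofPred_eq]
    rw [hH (r + 1) (by omega) e.1 h1 e.2, hS1, hS2, hw, hb]
  rw [DecodedDir, DecodedDir, ← hball _ (.inl rfl), Prod.swap_prod_mk, ← hball _ (.inr rfl)]
  refine or_congr (exists_congr fun m => and_congr_left fun hm => hmarks _ (.inl rfl) m hm)
    (and_congr_left fun _ => forall_congr' fun m => ?_)
  exact ⟨fun h h1 h2 => h ((hmarks _ (.inr rfl) m h2).2 h1) h2,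
    fun h h1 h2 => h ((hmarks _ (.inr rfl) m h2).1 h1) h2⟩

end Decoding

/-! ### Passing between nodes and identifiers -/

namespace Network

/-- The identifiers as an embedding. -/
def identEmbedding (N : Network) : N.V ↪ ℕ := ⟨N.ident, N.ident_injective⟩

/-- The graph of the network on the identifiers. -/
def idGraph (N : Network) : SimpleGraph ℕ := N.graph.map N.identEmbedding

variable {N : Network}

theorem idGraph_adj {a b : ℕ} :
    N.idGraph.Adj a b ↔ ∃ u v, N.graph.Adj u v ∧ N.ident u = a ∧ N.ident v = b :=
  SimpleGraph.map_adj _ _ _ _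

theorem idGraph_adj_ident {u v : N.V} :
    N.idGraph.Adj (N.ident u) (N.ident v) ↔ N.graph.Adj u v :=
  SimpleGraph.map_adj_apply (f := N.identEmbedding)

theorem idGraph_cball (v : N.V) (k : ℕ) :
    N.idGraph.cball (N.ident v) k = N.ident '' N.graph.cball v k :=
  SimpleGraph.cball_map N.identEmbedding v k

theorem degree_eq_ncard (v : N.V) : N.degree v = (N.graph.neighborSet v).ncard := by
  classical
  rw [degree, ← SimpleGraph.card_neighborFinset_eq_degree, SimpleGraph.neighborFinset,
    Set.ncard_eq_toFinset_card']

theorem idGraph_neighborSet {Δ : ℕ} (hN : N ∈ boundedDegree Δ) (x : ℕ) :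
    (N.idGraph.neighborSet x).Finite ∧ (N.idGraph.neighborSet x).ncard ≤ Δ := by
  by_cases hx : ∃ v, N.ident v = x
  · obtain ⟨v, rfl⟩ := hx
    have h : N.idGraph.neighborSet (N.ident v) = N.ident '' N.graph.neighborSet v := by
      ext y
      constructor
      · intro h
        obtain ⟨u, w, huw, h1, rfl⟩ := idGraph_adj.1 h
        rw [N.ident_injective h1] at huw
        exact ⟨w, huw, rfl⟩
      · rintro ⟨w, hw, rfl⟩
        exact idGraph_adj_ident.2 hw
    rw [h, Set.ncard_image_of_injective _ N.ident_injective, ← degree_eq_ncard]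
    exact ⟨Set.toFinite _, hN v⟩
  · have h : N.idGraph.neighborSet x = ∅ := by
      refine Set.eq_empty_of_forall_notMem fun y hy => hx ?_
      obtain ⟨u, w, -, h1, -⟩ := idGraph_adj.1 hy
      exact ⟨u, h1⟩
    simp [h]

theorem finite_darts_idGraph : {e : ℕ × ℕ | N.idGraph.Adj e.1 e.2}.Finite := by
  refine (Set.finite_range fun p : N.V × N.V => (N.ident p.1, N.ident p.2)).subset ?_
  rintro ⟨a, b⟩ h
  obtain ⟨u, v, -, rfl, rfl⟩ := idGraph_adj.1 h
  exact ⟨(u, v), rfl⟩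

end Network

theorem almostBalancedOrientation_of_dir {N : Network} {out : N.V → Finset ℕ}
    {dir : ℕ × ℕ → Prop} (hadj : ∀ d, dir d → N.idGraph.Adj d.1 d.2)
    (hswap : ∀ d : ℕ × ℕ, N.idGraph.Adj d.1 d.2 → (dir d.swap ↔ ¬ dir d))
    (hbal : ∀ v, |({u | dir (u, v)}.ncard : ℤ) - ({u | dir (v, u)}.ncard : ℤ)| ≤ 1)
    (hout : ∀ v, (out v : Set ℕ) = {y | dir (N.ident v, y)}) :
    almostBalancedOrientation N out := by
  have h1 : ∀ v : N.V, {y | dir (N.ident v, y)} =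
      N.ident '' {u | dir (N.ident v, N.ident u)} := fun v => by
    ext y
    refine ⟨fun h => ?_, ?_⟩
    · obtain ⟨u, w, -, -, rfl⟩ := Network.idGraph_adj.1 (hadj _ h)
      exact ⟨w, h, rfl⟩
    · rintro ⟨u, hu, rfl⟩
      exact hu
  have h2 : ∀ v : N.V, {y | dir (y, N.ident v)} =
      N.ident '' {u | dir (N.ident u, N.ident v)} := fun v => by
    ext y
    refine ⟨fun h => ?_, ?_⟩
    · obtain ⟨u, w, -, rfl, -⟩ := Network.idGraph_adj.1 (hadj _ h)
      exact ⟨u, h, rfl⟩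
    · rintro ⟨u, hu, rfl⟩
      exact hu
  refine ⟨⟨fun u v => dir (N.ident u, N.ident v),
    fun h => Network.idGraph_adj_ident.1 (hadj _ h), fun {u v} h => ?_⟩,
    fun v => (hout v).trans (h1 v), fun v => ?_⟩
  · have := hswap (N.ident v, N.ident u) (Network.idGraph_adj_ident.2 h.symm)
    exact this
  · have := hbal (N.ident v)
    rw [h1, h2, Set.ncard_image_of_injective _ N.ident_injective,
      Set.ncard_image_of_injective _ N.ident_injective] at this
    exact this

/-- The difference of in- and outdegree has the parity of the degree, so an even degree leaves only
zero. -/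
theorem balancedOrientation_of_almost {N : Network} {out : N.V → Finset ℕ}
    (h : almostBalancedOrientation N out) (heven : ∀ v, Even (N.degree v)) :
    balancedOrientation N out := by
  obtain ⟨o, ho, hbal⟩ := h
  refine ⟨o, ho, fun v => ?_⟩
  have hdeg : o.indeg v + o.outdeg v = N.degree v := by
    rw [Network.degree_eq_ncard, EdgeOrientation.indeg, EdgeOrientation.outdeg,
      ← Set.ncard_union_eq ?_ (Set.toFinite _) (Set.toFinite _)]
    · congr 1
      ext u
      constructor
      · rintro (h | h)
        · exact (o.adj_of_dir h).symm
        · exact o.adj_of_dir h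
      · intro h
        by_cases hd : o.dir v u
        · exact .inr hd
        · exact .inl ((o.dir_iff (SimpleGraph.Adj.symm h)).2 hd)
    · rw [Set.disjoint_left]
      intro u h1 h2
      exact (o.dir_iff (o.adj_of_dir h1)).1 h1 h2
  have h1 := hbal v
  obtain ⟨k, hk⟩ := heven v
  rw [abs_le] at h1
  omega

/-! ### Decisions made from local views -/

open scoped Classical in
/-- The output of a node that applies a decision rule to all its edges. -/
noncomputable def outputOf (Q : LocalView → ℕ → Prop) (w : LocalView) : Finset ℕ :=
  if h : {y | (w.ident, y) ∈ w.edges ∧ Q w y}.Finite then h.toFinset else ∅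

theorem coe_outputOf_view (Q : LocalView → ℕ → Prop) (N : Network) (S : Set N.V) {T : ℕ}
    (v : N.V) (hT : 0 < T ∨ N.degree v = 0) : (outputOf Q (N.view S T v) : Set ℕ) =
      {y | N.idGraph.Adj (N.ident v) y ∧ Q (N.view S T v) y} := by
  have hedge : ∀ y, (N.ident v, y) ∈ (N.view S T v).edges ↔ N.idGraph.Adj (N.ident v) y := by
    intro y
    constructor
    · rintro ⟨k, hk, a, ha, b, hab, h⟩
      obtain ⟨h1, rfl⟩ := Prod.mk.inj h
      rw [h1]
      exact Network.idGraph_adj_ident.2 hab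
    · intro h
      obtain ⟨a, b, hab, h1, rfl⟩ := Network.idGraph_adj.1 h
      obtain rfl := N.ident_injective h1
      rcases hT with hT | hT
      · exact ⟨0, hT, a, SimpleGraph.mem_cball_self, b, hab, rfl⟩
      · rw [Network.degree_eq_ncard, Set.ncard_eq_zero (Set.toFinite _)] at hT
        have : b ∈ N.graph.neighborSet a := hab
        rw [hT] at this
        exact absurd this (Set.notMem_empty _)
  have hset : {y | ((N.view S T v).ident, y) ∈ (N.view S T v).edges ∧ Q (N.view S T v) y} =
      {y | N.idGraph.Adj (N.ident v) y ∧ Q (N.view S T v) y} :=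
    Set.ext fun y => and_congr_left fun _ => hedge y
  have hfin : {y | ((N.view S T v).ident, y) ∈ (N.view S T v).edges ∧
      Q (N.view S T v) y}.Finite := by
    rw [hset]
    exact (Network.idGraph_neighborSet (Δ := N.maxDegree)
      (fun u => by classical exact N.graph.degree_le_maxDegree u) _).1.subset fun y hy => hy.1
  rw [outputOf, dif_pos hfin, Set.Finite.coe_toFinset, hset]

/-- The part of the graph that a node knows. -/
def LocalView.graph (w : LocalView) : SimpleGraph ℕ :=
  SimpleGraph.fromRel fun a b => (a, b) ∈ w.edges

theorem view_graph_adj {N : Network} {S : Set N.V} {T : ℕ} {v : N.V} {k x : ℕ} (hk : k < T)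
    (hx : x ∈ N.idGraph.cball (N.ident v) k) (y : ℕ) :
    N.idGraph.Adj x y ↔ (N.view S T v).graph.Adj x y := by
  have hsub : ∀ a b, (a, b) ∈ (N.view S T v).edges → N.idGraph.Adj a b := by
    rintro _ _ ⟨_, -, a, -, b, hab, h⟩
    obtain ⟨rfl, rfl⟩ := Prod.mk.inj h
    exact Network.idGraph_adj_ident.2 hab
  rw [LocalView.graph, SimpleGraph.fromRel_adj]
  constructor
  · intro h
    refine ⟨h.ne, .inl ?_⟩
    rw [Network.idGraph_cball] at hx
    obtain ⟨a, ha, rfl⟩ := hx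
    obtain ⟨a', b, hab, h1, rfl⟩ := Network.idGraph_adj.1 h
    obtain rfl := N.ident_injective h1
    exact ⟨k, hk, a', ha, b, hab, rfl⟩
  · rintro ⟨-, h | h⟩
    · exact hsub _ _ h
    · exact (hsub _ _ h).symm

theorem mem_view_marks {N : Network} {S : Set ℕ} {T : ℕ} {v : N.V} {x : ℕ}
    (hx : x ∈ N.idGraph.cball (N.ident v) T) :
    x ∈ S ↔ x ∈ (N.view (N.ident ⁻¹' S) T v).marks := by
  rw [Network.idGraph_cball] at hx
  obtain ⟨u, hu, rfl⟩ := hx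
  constructor
  · exact fun h => ⟨u, hu, h, rfl⟩
  · rintro ⟨w, -, hw, h⟩
    rw [h]
    exact hw

/-! ### A sparse marked set and the number of rounds -/

theorem pow_bound {Δ α : ℕ} (hΔ : 2 ≤ Δ) (hα : 1 ≤ α) :
    3 * (4 * (Δ + 1) ^ (2 * α + 8 + 1)) + 5 ≤ Δ ^ (27 * α) := by
  have h0 : 1 ≤ (Δ + 1) ^ (2 * α + 8 + 1) := Nat.one_le_pow _ _ Δ.succ_pos
  have h1 : Δ + 1 ≤ Δ ^ 2 := by nlinarith
  calc 3 * (4 * (Δ + 1) ^ (2 * α + 8 + 1)) + 5 ≤ 2 ^ 5 * (Δ + 1) ^ (2 * α + 8 + 1) := by omega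
    _ ≤ Δ ^ 5 * (Δ ^ 2) ^ (2 * α + 8 + 1) :=
        Nat.mul_le_mul (Nat.pow_le_pow_left hΔ 5) (Nat.pow_le_pow_left h1 _)
    _ = Δ ^ (5 + 2 * (2 * α + 8 + 1)) := by rw [← pow_mul, ← pow_add]
    _ ≤ Δ ^ (27 * α) := Nat.pow_le_pow_right (by omega) (by omega)

/-- Here `Δ ^ (27 * α)` is at most 1, too small for the general algorithm. The edges form a
matching, and any orientation is almost balanced; pointing to the larger identifier takes one round,
and none if `Δ = 0`. -/
theorem exists_schema_of_degree_le_one {Δ : ℕ} (hΔ : Δ ≤ 1) :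
    ∃ 𝒜 : LocalAlgorithm (Finset ℕ), 𝒜.rounds = Δ ∧ ∀ N ∈ boundedDegree Δ,
      ∀ l : N.V → List Bool, almostBalancedOrientation N (𝒜.run N l) := by
  refine ⟨gatherAlgorithm Δ (outputOf fun w y => w.ident < y), rfl, fun N hN l => ?_⟩
  refine almostBalancedOrientation_of_dir (dir := fun d => N.idGraph.Adj d.1 d.2 ∧ d.1 < d.2)
    (fun d h => h.1) (fun d hd => ?_) (fun v => ?_) fun v => ?_
  · have := hd.ne
    have := hd.symm
    simp only [Prod.fst_swap, Prod.snd_swap, hd, this, true_and]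
    omega
  · obtain ⟨hf, hc⟩ := Network.idGraph_neighborSet hN v
    have h1 : {u | N.idGraph.Adj u v ∧ u < v}.ncard ≤ 1 :=
      (Set.ncard_le_ncard (fun u hu => N.idGraph.adj_symm hu.1) hf).trans (hc.trans hΔ)
    have h2 : {u | N.idGraph.Adj v u ∧ v < u}.ncard ≤ 1 :=
      (Set.ncard_le_ncard (fun u hu => hu.1) hf).trans (hc.trans hΔ)
    rw [abs_le]
    simp only
    omega
  · rw [gatherAlgorithm_run _ _ N l {v | l v = [true]} fun _ => Iff.rfl]
    have := hN v
    exact coe_outputOf_view _ N _ v (by omega)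

theorem exists_schema_of_two_le {Δ α : ℕ} (hΔ : 2 ≤ Δ) (hα : 1 ≤ α) :
    ∃ 𝒜 : LocalAlgorithm (Finset ℕ), 𝒜.rounds ≤ Δ ^ (27 * α) ∧ ∀ N ∈ boundedDegree Δ,
      ∃ S : Set N.V, (∀ v, (N.ball v α ∩ S).ncard ≤ 3) ∧ S.ncard * (α + 1) ≤ 3 * N.size ∧
        ∀ l : N.V → List Bool, (∀ v, l v = [true] ↔ v ∈ S) →
          almostBalancedOrientation N (𝒜.run N l) := by
  set s := 4 * (Δ + 1) ^ (2 * α + 8 + 1) with hs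
  refine ⟨gatherAlgorithm (3 * s + 5) (outputOf fun w y =>
    DecodedDir w.graph w.marks (3 * s) (w.ident, y)), pow_bound hΔ hα, fun N hN => ?_⟩
  have hdeg := Network.idGraph_neighborSet hN
  obtain ⟨M, hMdir, hMsep, hMfar, hMlong⟩ :=
    exists_marks hdeg Network.finite_darts_idGraph (2 * α + 8) hs.ge
  have hMadj : ∀ m ∈ M, N.idGraph.Adj m.1 m.2 := fun m hm => (hMdir m hm).1
  have hM3 : ∀ m ∈ M, N.idGraph.edist m.1 (thirdNode N.idGraph m.1) = (3 : ℕ) := fun m hm => by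
    obtain ⟨x, hx, hxR⟩ := hMfar m hm
    exact edist_thirdNode (by omega) hx hxR
  have hMfin : M.Finite := Network.finite_darts_idGraph.subset hMadj
  have hdec := markedEdges_markedNodes (by omega) hMadj hMsep hM3
  have hgball : ∀ m ∈ M, gadget N.idGraph m ⊆ N.idGraph.cball m.1 3 := fun m hm =>
    gadget_subset_cball (hMadj m hm) (hM3 m hm)
  refine ⟨N.ident ⁻¹' markedNodes N.idGraph M, fun v => ?_, ?_, fun l hl => ?_⟩
  · rcases Set.eq_empty_or_nonempty (N.ball v α ∩ N.ident ⁻¹' markedNodes N.idGraph M) with h | h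
    · rw [h]; simp
    · obtain ⟨u, hu, m, hm, hum⟩ := h
      have hball : ∀ w ∈ N.ball v α, N.ident w ∈ N.idGraph.cball (N.ident v) α := fun w hw => by
        rw [Network.idGraph_cball]
        exact ⟨w, hw, rfl⟩
      refine (Set.ncard_le_ncard_of_injOn N.ident ?_ N.ident_injective.injOn
        (finite_gadget m)).trans (ncard_gadget_le (H := N.idGraph) m)
      rintro w ⟨hw, m', hm', hwm'⟩
      -- Two gadgets meeting the ball have tails within `3 + α + α + 3 ≤ 2 * α + 8`, so they
      -- coincide.
      have h1 := SimpleGraph.mem_cball_add (SimpleGraph.mem_cball_add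
        (SimpleGraph.mem_cball_add (hgball m hm hum)
          (SimpleGraph.mem_cball_comm.1 (hball u hu))) (hball w hw))
        (SimpleGraph.mem_cball_comm.1 (hgball m' hm' hwm'))
      rwa [hMsep m hm m' hm' (SimpleGraph.cball_mono (by omega) h1)]
  · classical
    have hbfin := fun c => (SimpleGraph.finite_cball_and_ncard_le hdeg c α).1
    have h1 : (N.ident ⁻¹' markedNodes N.idGraph M).ncard ≤ hMfin.toFinset.card * 3 := by
      have hsub : N.ident '' (N.ident ⁻¹' markedNodes N.idGraph M) ⊆
          ↑(hMfin.toFinset.biUnion fun m => (finite_gadget (H := N.idGraph) m).toFinset) := by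
        rintro _ ⟨x, ⟨m, hm, hx⟩, rfl⟩
        simp only [Finset.coe_biUnion, Set.Finite.coe_toFinset, Set.mem_iUnion]
        exact ⟨m, hm, hx⟩
      have h2 := Set.ncard_le_ncard hsub (Finset.finite_toSet _)
      rw [Set.ncard_image_of_injective _ N.ident_injective, Set.ncard_coe_finset] at h2
      refine h2.trans (Finset.card_biUnion_le_card_mul _ _ 3 fun m _ => ?_)
      rw [← Set.ncard_eq_toFinset_card _ (finite_gadget m)]
      exact ncard_gadget_le m
    -- The balls of radius `α` around the tails are disjoint. Each has more than `α` nodes, since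
    -- its component extends beyond distance `2 * α + 8`.
    have h2 : hMfin.toFinset.card * (α + 1) ≤ N.size := by
      have hdisj : (hMfin.toFinset : Set (ℕ × ℕ)).PairwiseDisjoint
          fun m => (hbfin m.1).toFinset := by
        intro m hm m' hm' hne
        rw [Function.onFun, Set.Finite.disjoint_toFinset, Set.disjoint_left]
        intro x hx hx'
        have := SimpleGraph.mem_cball_add hx (SimpleGraph.mem_cball_comm.1 hx')
        exact hne (hMsep m (hMfin.mem_toFinset.1 hm) m' (hMfin.mem_toFinset.1 hm')
          (SimpleGraph.cball_mono (by omega) this))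
      have hsub : hMfin.toFinset.biUnion (fun m => (hbfin m.1).toFinset) ⊆
          Finset.univ.image N.ident := by
        intro x hx
        rw [Finset.mem_biUnion] at hx
        obtain ⟨m, hm, hx⟩ := hx
        obtain ⟨u, w, -, hu, -⟩ := Network.idGraph_adj.1 (hMadj m (hMfin.mem_toFinset.1 hm))
        rw [Set.Finite.mem_toFinset, ← hu, Network.idGraph_cball] at hx
        obtain ⟨y, -, rfl⟩ := hx
        exact Finset.mem_image_of_mem _ (Finset.mem_univ _)
      have h3 := (Finset.card_le_card hsub).trans Finset.card_image_le
      rw [Finset.card_biUnion hdisj] at h3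
      refine le_trans ?_ h3
      rw [← smul_eq_mul]
      refine Finset.card_nsmul_le_sum _ _ _ fun m hm => ?_
      rw [← Set.ncard_eq_toFinset_card _ (hbfin m.1)]
      obtain ⟨x, hx, hxR⟩ := hMfar m (hMfin.mem_toFinset.1 hm)
      refine SimpleGraph.lt_ncard_cball (hbfin m.1) hx (le_of_lt ?_)
      refine lt_of_le_of_lt ?_ (not_le.1 hxR)
      exact_mod_cast (by omega : α ≤ 2 * α + 8)
    nlinarith
  · refine almostBalancedOrientation_of_dir (dir := TrailDir N.idGraph) (fun d h => h.1)
      (fun d hd => trailDir_swap hd) (fun v => trailDir_balanced (hdeg v).1) fun v => ?_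
    rw [gatherAlgorithm_run _ _ N l _ hl, coe_outputOf_view _ N _ v (.inl (by omega))]
    ext y
    have key : N.idGraph.Adj (N.ident v) y →
        (DecodedDir N.idGraph (markedNodes N.idGraph M) (3 * s) (N.ident v, y) ↔
          TrailDir N.idGraph (N.ident v, y)) := fun h =>
      decodedDir_iff le_rfl hMdir hdec hMlong h
    constructor
    · rintro ⟨h, hQ⟩
      exact (key h).1 ((decodedDir_congr h (fun k hk x hx y => view_graph_adj hk hx y)
        fun x hx => mem_view_marks hx).2 hQ)
    · intro h
      exact ⟨h.1, (decodedDir_congr h.1 (fun k hk x hx y => view_graph_adj hk hx y)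
        fun x hx => mem_view_marks hx).1 ((key h.1).2 h)⟩

/-- A sparse set of nodes from which an almost balanced orientation can be reconstructed. -/
theorem exists_schema (Δ : ℕ) {α : ℕ} (hα : 1 ≤ α) :
    ∃ 𝒜 : LocalAlgorithm (Finset ℕ), 𝒜.rounds ≤ Δ ^ (27 * α) ∧ ∀ N ∈ boundedDegree Δ,
      ∃ S : Set N.V, (∀ v, (N.ball v α ∩ S).ncard ≤ 3) ∧ S.ncard * (α + 1) ≤ 3 * N.size ∧
        ∀ l : N.V → List Bool, (∀ v, l v = [true] ↔ v ∈ S) →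
          almostBalancedOrientation N (𝒜.run N l) := by
  rcases Nat.lt_or_ge Δ 2 with hΔ | hΔ
  · obtain ⟨𝒜, h1, h2⟩ := exists_schema_of_degree_le_one (Nat.lt_succ_iff.1 hΔ)
    refine ⟨𝒜, ?_, fun N hN => ⟨∅, by simp, by simp, fun l _ => h2 N hN l⟩⟩
    rw [h1]
    exact Nat.le_self_pow (by omega) Δ
  · exact exists_schema_of_two_le hΔ hα

/-! ### The composable and the sparse schemas -/

theorem isTheta_cube {c : ℝ} (hc : 0 < c) :
    (fun γ : ℕ => (γ : ℝ) ^ 3 / c + 1) =Θ[atTop] fun γ : ℕ => (γ : ℝ) ^ 3 := by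
  constructor
  · refine IsBigO.of_bound (1 / c + 1) ?_
    filter_upwards [eventually_ge_atTop 1] with γ hγ
    have h1 : (1 : ℝ) ≤ (γ : ℝ) ^ 3 := one_le_pow₀ (by exact_mod_cast hγ)
    have h2 : 0 ≤ (γ : ℝ) ^ 3 / c + 1 := by positivity
    rw [Real.norm_of_nonneg h2, Real.norm_of_nonneg (by positivity)]
    calc (γ : ℝ) ^ 3 / c + 1 ≤ (γ : ℝ) ^ 3 / c + (γ : ℝ) ^ 3 := by gcongr
      _ = (1 / c + 1) * (γ : ℝ) ^ 3 := by ring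
  · refine IsBigO.of_bound c (Eventually.of_forall fun γ => ?_)
    have h2 : 0 ≤ (γ : ℝ) ^ 3 / c + 1 := by positivity
    rw [Real.norm_of_nonneg h2, Real.norm_of_nonneg (by positivity), mul_add,
      mul_div_cancel₀ _ hc.ne']
    linarith

theorem hasComposableSchemas_of_almostBalanced {𝒢 : ℕ → Set Network}
    {P : GraphProblem (Finset ℕ)} (h𝒢 : ∀ Δ, 𝒢 Δ ⊆ boundedDegree Δ)
    (hP : ∀ Δ, ∀ N ∈ 𝒢 Δ, ∀ out, almostBalancedOrientation N out → P N out) :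
    HasComposableSchemas 𝒢 P := by
  classical
  -- A gadget has at most 3 nodes. Strings have length at most `β = 1`, which requires `α ≥ γ ^ 3 /
  -- c`; the extra 1 ensures `α ≥ 1`.
  refine ⟨3, fun c γ => (γ : ℝ) ^ 3 / c + 1, fun α Δ => Δ ^ (27 * α), fun c hc => isTheta_cube hc,
    ⟨27, fun _ _ => le_rfl⟩, fun Δ c hc γ hγ α hα => ⟨1, ?_, ?_⟩⟩
  · have hγ0 : (0 : ℝ) < (γ : ℝ) ^ 3 := by
      have : (0 : ℝ) < γ := by exact_mod_cast (by omega : 0 < γ)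
      positivity
    rw [Nat.cast_one, le_div_iff₀ hγ0, one_mul]
    have h1 : (γ : ℝ) ^ 3 / c ≤ α := by linarith
    rw [div_le_iff₀ hc] at h1
    linarith
  · have hα1 : 1 ≤ α := by
      have h1 : (0 : ℝ) ≤ (γ : ℝ) ^ 3 / c := by positivity
      exact_mod_cast (by linarith : (1 : ℝ) ≤ α)
    obtain ⟨𝒜, hrounds, h⟩ := exists_schema Δ hα1
    choose! S hS1 _ hS3 using h
    refine ⟨fun N v => if v ∈ S N then [true] else [],
      ⟨fun N _ v => by simp only; split_ifs <;> simp, 𝒜, hrounds, fun N hN => ?_⟩, fun N hN v => ?_⟩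
    · exact hP Δ N hN _ (hS3 N (h𝒢 Δ hN) _ fun v => by simp)
    · have hset : bitHolding (fun N v => if v ∈ S N then [true] else []) N = S N := by
        ext u
        simp [bitHolding]
      rw [hset]
      exact hS1 N (h𝒢 Δ hN) v

theorem hasSparseSchemas_of_almostBalanced {𝒢 : ℕ → Set Network}
    {P : GraphProblem (Finset ℕ)} (h𝒢 : ∀ Δ, 𝒢 Δ ⊆ boundedDegree Δ)
    (hP : ∀ Δ, ∀ N ∈ 𝒢 Δ, ∀ out, almostBalancedOrientation N out → P N out) :
    HasSparseSchemas 𝒢 P := by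
  classical
  -- With `α = ⌈3 / ε⌉₊ + 1` the density bound `3 / (α + 1)` is at most `ε`.
  refine ⟨fun ε Δ => Δ ^ (27 * (⌈3 / ε⌉₊ + 1)), fun ε _ => ⟨_, fun _ => le_rfl⟩,
    fun Δ ε hε => ?_⟩
  obtain ⟨𝒜, hrounds, h⟩ := exists_schema Δ (Nat.le_add_left 1 ⌈3 / ε⌉₊)
  choose! S _ hS2 hS3 using h
  refine ⟨fun N v => if v ∈ S N then [true] else [false],
    ⟨fun N _ v => by simp only; split_ifs <;> simp, 𝒜, hrounds, fun N hN => ?_⟩,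
    fun N _ u v => by simp only; split_ifs <;> rfl, fun N _ v => by simp only; split_ifs <;> rfl,
    fun N hN => ?_⟩
  · exact hP Δ N hN _ (hS3 N (h𝒢 Δ hN) _ fun v => by simp)
  · have htrue : bitCount (fun N v => if v ∈ S N then [true] else [false]) N true =
        (S N).ncard := by
      rw [bitCount]
      congr 1
      ext u
      simp
    have hfalse : bitCount (fun N v => if v ∈ S N then [true] else [false]) N false =
        (S N)ᶜ.ncard := by
      rw [bitCount]
      congr 1
      ext u
      simp
    have hsize : (S N)ᶜ.ncard + (S N).ncard = N.size := by
      rw [add_comm, Set.ncard_add_ncard_compl, Network.size, Nat.card_eq_fintype_card]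
    rw [htrue, hfalse, ← Nat.cast_add, hsize]
    -- In the empty network the fraction is `0 / 0`, which is 0 by convention.
    rcases Nat.eq_zero_or_pos N.size with h0 | h0
    · rw [h0, Nat.cast_zero, div_zero]
      exact hε.le
    rw [div_le_iff₀ (by exact_mod_cast h0)]
    have h1 : ((S N).ncard : ℝ) * (⌈3 / ε⌉₊ + 1 + 1) ≤ 3 * N.size := by
      exact_mod_cast hS2 N (h𝒢 Δ hN)
    have h2 : 3 / ε ≤ (⌈3 / ε⌉₊ : ℝ) := Nat.le_ceil _
    have h3 : ((S N).ncard : ℝ) * (3 / ε) ≤ 3 * N.size :=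
      (mul_le_mul_of_nonneg_left (by linarith) (Nat.cast_nonneg _)).trans h1
    rw [mul_div_assoc', div_le_iff₀ hε] at h3
    linarith

theorem mainTheorem4 :
    (HasComposableSchemas boundedEvenDegree balancedOrientation ∧
      HasSparseSchemas boundedEvenDegree balancedOrientation) ∧
    (HasComposableSchemas boundedDegree almostBalancedOrientation ∧
      HasSparseSchemas boundedDegree almostBalancedOrientation) := by
  have hsub : ∀ Δ, boundedEvenDegree Δ ⊆ boundedDegree Δ := fun Δ N hN v => (hN v).1
  have hP : ∀ Δ, ∀ N ∈ boundedEvenDegree Δ, ∀ out, almostBalancedOrientation N out →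
      balancedOrientation N out := fun Δ N hN out h =>
    balancedOrientation_of_almost h fun v => (hN v).2
  exact ⟨⟨hasComposableSchemas_of_almostBalanced hsub hP,
      hasSparseSchemas_of_almostBalanced hsub hP⟩,
    hasComposableSchemas_of_almostBalanced (fun _ => subset_rfl) fun _ _ _ _ h => h,
    hasSparseSchemas_of_almostBalanced (fun _ => subset_rfl) fun _ _ _ _ h => h⟩
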